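/- Let $\mathcal X$ be a separable real Hilbert space and let $f:\mathcal X\to\mathbb R$ be convex and continuously differentiable with $\|\nabla f(x)-\nabla f(y)\|\le L\|x-y\|$ for all $x,y\in\mathcal X$ and some $L>0$, and suppose $\operatorname{argmin} f\neq\emptyset$. Let $x_*$ denote the element of $\operatorname{argmin} f$ of minimal norm and, for $\lambda>0$, let $x_\lambda$ denote the unique minimizer of $f_\lambda(x)=f(x)+\frac{\lambda}{2}\|x\|^2$. Let $C_\alpha,C_\lambda>0$, $p\in(0,\frac13)$, $q\in(\frac{p+1}{2},1-p)$, and set $\alpha_k=C_\alpha k^{-q}$, $\lambda_k=C_\lambda k^{-p}$ for $k\ge1$. On a probability space with filtration $(\mathcal F_k)_{k\ge0}$, let $(X_k)_{k\ge0}$ be an adapted $\mathcal X$-valued sequence with $\mathbb E\|X_0\|^2<\infty$ and $$X_k=X_{k-1}-\alpha_k\bigl(\nabla f(X_{k-1})+\lambda_kX_{k-1}+D_k\bigr),\qquad k\ge1,$$ where $(D_k)_{k\ge1}$ is an adapted sequence of martingale differences, i.e. $D_k$ is integrable and $\mathbb E[D_k\mid\mathcal F_{k-1}]=0$, such that for some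 constants $A,C\ge0$, almost surely, $$\mathbb E\bigl[\|D_k\|^2\mid\mathcal F_{k-1}\bigr]\le A\bigl(f(X_{k-1})-f(x_*)\bigr)+C,\qquad k\ge1.$$ Then, for every $\beta\in(0,2q-1)$, almost surely $\lim_{k\to\infty}\|X_k-x_*\|=0$ and, as $k\to\infty$, (i) $f(X_k)-f(x_*)\in\mathcal O\bigl(k^{-\min(\beta,p)}\bigr)$ almost surely, (ii) $\|X_k-x_{\lambda_{k+1}}\|^2\in\mathcal O\bigl(k^{-\min(\beta-p,\,1-q-p)}\bigr)$ almost surely. -/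

import Mathlib

open MeasureTheory Filter Topology Set
open scoped ENNReal

noncomputable section

namespace TikhonovSGD

section Optimization

variable {H : Type*} [NormedAddCommGroup H] [InnerProductSpace ℝ H]

/-- The set of global minimizers of `f`. -/
def argminSet (f : H → ℝ) : Set H := {x | ∀ y, f x ≤ f y}

/-- `x` is a global minimizer of `f` whose norm is smallest among all global minimizers. -/
def IsMinNormSolution (f : H → ℝ) (x : H) : Prop :=
  x ∈ argminSet f ∧ ∀ y ∈ argminSet f, ‖x‖ ≤ ‖y‖

/-- The Tikhonov regularized objective `f_l(x) = f(x) + (l / 2) ‖x‖²`. -/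
def tikhonov (f : H → ℝ) (l : ℝ) (x : H) : ℝ := f x + l / 2 * ‖x‖ ^ 2

/-- The minimum-norm solution `x_*` of `min f`; it exists and is unique for convex continuous `f`
on a Hilbert space that attains its minimum, see `existsUnique_isMinNormSolution`. -/
def minNormSolution (f : H → ℝ) : H := Classical.epsilon (IsMinNormSolution f)

/-- The minimizer `x_l` of the regularized objective `f_l`; it exists and is unique for `l > 0`
and `f` as above, see `existsUnique_mem_argminSet_tikhonov`. -/
def tikhonovMinimizer (f : H → ℝ) (l : ℝ) : H :=
  Classical.epsilon fun x => x ∈ argminSet (tikhonov f l)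

/-- Convex, continuously differentiable and `L`-smooth objectives that attain their minimum. -/
structure IsSmoothConvexObjective [CompleteSpace H] (f : H → ℝ) (L : ℝ) : Prop where
  convexOn : ConvexOn ℝ univ f
  contDiff : ContDiff ℝ 1 f
  lipschitz_gradient : ∀ x y, ‖gradient f x - gradient f y‖ ≤ L * ‖x - y‖
  argmin_nonempty : (argminSet f).Nonempty

lemma tikhonov_midpoint {f : H → ℝ} (hf : ConvexOn ℝ univ f) (l : ℝ) (x y : H) :
    tikhonov f l ((1 / 2 : ℝ) • x + (1 / 2 : ℝ) • y) + l / 8 * ‖x - y‖ ^ 2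
      ≤ (tikhonov f l x + tikhonov f l y) / 2 := by
  have h1 := hf.2 (mem_univ x) (mem_univ y) (by norm_num : (0 : ℝ) ≤ 1 / 2)
    (by norm_num : (0 : ℝ) ≤ 1 / 2) (by norm_num)
  have h2 := parallelogram_law_with_norm ℝ x y
  have h3 : ‖(1 / 2 : ℝ) • x + (1 / 2 : ℝ) • y‖ = 1 / 2 * ‖x + y‖ := by
    rw [← smul_add, norm_smul]; norm_num
  simp only [smul_eq_mul] at h1
  have h4 : ‖x + y‖ ^ 2 = 2 * (‖x‖ ^ 2 + ‖y‖ ^ 2) - ‖x - y‖ ^ 2 := by nlinarith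
  unfold tikhonov
  rw [h3, mul_pow, h4]
  nlinarith

lemma existsUnique_mem_argminSet_tikhonov [CompleteSpace H] {f : H → ℝ}
    (hf : ConvexOn ℝ univ f) (hc : Continuous f) (hne : (argminSet f).Nonempty)
    {l : ℝ} (hl : 0 < l) : ∃! x, x ∈ argminSet (tikhonov f l) := by
  obtain ⟨z, hz⟩ := hne
  have hbdd : BddBelow (range (tikhonov f l)) := by
    refine ⟨f z, ?_⟩
    rintro _ ⟨x, rfl⟩
    have h := hz x
    unfold tikhonov
    have : 0 ≤ l / 2 * ‖x‖ ^ 2 := by positivity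
    linarith
  have hlow : ∀ x, (⨅ y, tikhonov f l y) ≤ tikhonov f l x := fun x => ciInf_le hbdd x
  have hcont : Continuous (tikhonov f l) := by unfold tikhonov; fun_prop
  have hex : ∀ n : ℕ, ∃ x, tikhonov f l x < (⨅ y, tikhonov f l y) + 1 / ((n : ℝ) + 1) := by
    intro n
    exact exists_lt_of_ciInf_lt (lt_add_of_pos_right _ (by positivity))
  choose u hu using hex
  have hdist : ∀ n m N : ℕ, N ≤ n → N ≤ m →
      dist (u n) (u m) ≤ Real.sqrt (8 / l * (1 / ((N : ℝ) + 1))) := by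
    intro n m N hn hm
    apply Real.le_sqrt_of_sq_le
    have h1 := tikhonov_midpoint hf l (u n) (u m)
    have h2 := hlow ((1 / 2 : ℝ) • u n + (1 / 2 : ℝ) • u m)
    have h3 : 1 / ((n : ℝ) + 1) ≤ 1 / ((N : ℝ) + 1) := Nat.one_div_le_one_div hn
    have h4 : 1 / ((m : ℝ) + 1) ≤ 1 / ((N : ℝ) + 1) := Nat.one_div_le_one_div hm
    have h5 := hu n
    have h6 := hu m
    rw [dist_eq_norm]
    have h7 : l / 8 * ‖u n - u m‖ ^ 2 ≤ 1 / ((N : ℝ) + 1) := by linarith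
    calc ‖u n - u m‖ ^ 2 = 8 / l * (l / 8 * ‖u n - u m‖ ^ 2) := by field_simp
      _ ≤ 8 / l * (1 / ((N : ℝ) + 1)) := by gcongr
  have hlim0 : Tendsto (fun N : ℕ => Real.sqrt (8 / l * (1 / ((N : ℝ) + 1)))) atTop (𝓝 0) := by
    have := ((tendsto_one_div_add_atTop_nhds_zero_nat (𝕜 := ℝ)).const_mul (8 / l)).sqrt
    simpa using this
  obtain ⟨x, hx⟩ := cauchySeq_tendsto_of_complete (cauchySeq_of_le_tendsto_0 _ hdist hlim0)
  have hxle : tikhonov f l x ≤ ⨅ y, tikhonov f l y := by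
    have h1 : Tendsto (fun n => tikhonov f l (u n)) atTop (𝓝 (tikhonov f l x)) :=
      (hcont.tendsto x).comp hx
    have h2 : Tendsto (fun n : ℕ => (⨅ y, tikhonov f l y) + 1 / ((n : ℝ) + 1)) atTop
        (𝓝 ((⨅ y, tikhonov f l y) + 0)) :=
      tendsto_const_nhds.add tendsto_one_div_add_atTop_nhds_zero_nat
    rw [add_zero] at h2
    exact le_of_tendsto_of_tendsto' h1 h2 fun n => (hu n).le
  refine ⟨x, fun y => hxle.trans (hlow y), ?_⟩
  intro y hy
  have h1 := tikhonov_midpoint hf l y x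
  have h2 := hlow ((1 / 2 : ℝ) • y + (1 / 2 : ℝ) • x)
  have h3 : tikhonov f l y ≤ tikhonov f l x := hy x
  have h4 : ‖y - x‖ ^ 2 ≤ 0 := by
    have : l / 8 * ‖y - x‖ ^ 2 ≤ 0 := by linarith
    by_contra hcon
    push Not at hcon
    have : 0 < l / 8 * ‖y - x‖ ^ 2 := by positivity
    linarith
  have h5 : ‖y - x‖ = 0 := by
    have := sq_nonneg ‖y - x‖
    exact pow_eq_zero_iff (two_ne_zero) |>.1 (le_antisymm h4 this)
  exact sub_eq_zero.1 (norm_eq_zero.1 h5)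

lemma existsUnique_isMinNormSolution [CompleteSpace H] {f : H → ℝ}
    (hf : ConvexOn ℝ univ f) (hc : Continuous f) (hne : (argminSet f).Nonempty) :
    ∃! x, IsMinNormSolution f x := by
  obtain ⟨z, hz⟩ := hne
  have hset : argminSet f = {x | f x ≤ f z} := by
    ext x
    exact ⟨fun h => h z, fun h y => le_trans h (hz y)⟩
  have hclosed : IsClosed (argminSet f) := by
    rw [hset]; exact isClosed_le hc continuous_const
  have hconv : Convex ℝ (argminSet f) := by
    rw [hset]; simpa using hf.convex_le (f z)
  obtain ⟨v, hv, hmin⟩ :=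
    exists_norm_eq_iInf_of_complete_convex ⟨z, hz⟩ hclosed.isComplete hconv 0
  have hvmin : IsMinNormSolution f v := by
    refine ⟨hv, fun y hy => ?_⟩
    have hb : BddBelow (range fun w : argminSet f => ‖(0 : H) - w‖) :=
      ⟨0, by rintro _ ⟨w, rfl⟩; exact norm_nonneg _⟩
    have := ciInf_le hb ⟨y, hy⟩
    rw [← hmin] at this
    simpa using this
  refine ⟨v, hvmin, fun y hy => ?_⟩
  have h1 : (1 / 2 : ℝ) • y + (1 / 2 : ℝ) • v ∈ argminSet f :=
    hconv hy.1 hv (by norm_num) (by norm_num) (by norm_num)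
  have h2 := hvmin.2 _ h1
  have h3 : ‖(1 / 2 : ℝ) • y + (1 / 2 : ℝ) • v‖ = 1 / 2 * ‖y + v‖ := by
    rw [← smul_add, norm_smul]; norm_num
  have h4 := parallelogram_law_with_norm ℝ y v
  have h5 := hy.2 v hv
  have h6 := norm_nonneg v
  have h7 := norm_nonneg y
  rw [h3] at h2
  have h8 : ‖y - v‖ * ‖y - v‖ ≤ 0 := by nlinarith
  have h9 : ‖y - v‖ = 0 := mul_self_eq_zero.1 (le_antisymm h8 (mul_self_nonneg _))
  exact sub_eq_zero.1 (norm_eq_zero.1 h9)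

lemma IsSmoothConvexObjective.isMinNormSolution [CompleteSpace H] {f : H → ℝ} {L : ℝ}
    (hf : IsSmoothConvexObjective f L) : IsMinNormSolution f (minNormSolution f) :=
  Classical.epsilon_spec
    (existsUnique_isMinNormSolution hf.convexOn hf.contDiff.continuous hf.argmin_nonempty).exists

lemma IsSmoothConvexObjective.tikhonovMinimizer_mem [CompleteSpace H] {f : H → ℝ} {L : ℝ}
    (hf : IsSmoothConvexObjective f L) {l : ℝ} (hl : 0 < l) :
    tikhonovMinimizer f l ∈ argminSet (tikhonov f l) :=
  Classical.epsilon_spec (existsUnique_mem_argminSet_tikhonov hf.convexOn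
    hf.contDiff.continuous hf.argmin_nonempty hl).exists

end Optimization

section Scheme

variable {H : Type*} [NormedAddCommGroup H] [InnerProductSpace ℝ H] [CompleteSpace H]
variable {Ω : Type*} {mΩ : MeasurableSpace Ω}

/-- The polynomial schedule `k ↦ C k ^ (-r)`; only its values at `k ≥ 1` are used. -/
def polySchedule (C r : ℝ) (k : ℕ) : ℝ := C * (k : ℝ) ^ (-r)

/-- `(X_k)_{k ≥ 0}` is generated by regularized SGD with deterministic step sizes `(α_k)_{k ≥ 1}`,
regularization parameters `(l_k)_{k ≥ 1}` and noise `(D_k)_{k ≥ 1}`, a sequence of martingale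
differences. The values of `α`, `l` and `D` at index `0` are irrelevant. -/
structure IsRegSGD (f : H → ℝ) (α l : ℕ → ℝ) (μ : Measure Ω) (ℱ : Filtration ℕ mΩ)
    (X D : ℕ → Ω → H) : Prop where
  adapted_iterates : StronglyAdapted ℱ X
  memLp_init : MemLp (X 0) 2 μ
  adapted_noise : ∀ k, StronglyMeasurable[ℱ (k + 1)] (D (k + 1))
  integrable_noise : ∀ k, Integrable (D (k + 1)) μ
  condExp_noise : ∀ k, μ[D (k + 1) | ℱ k] =ᵐ[μ] 0
  step : ∀ k ω, X (k + 1) ω =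
    X k ω - α (k + 1) • (gradient f (X k ω) + l (k + 1) • X k ω + D (k + 1) ω)

/-- The second moment condition `E[‖D_k‖² | ℱ_{k-1}] ≤ A (f(X_{k-1}) - f(x_*)) + C` for `k ≥ 1`,
almost surely. The conditional expectation is the `[0, ∞]`-valued one, so that no integrability of
`‖D_k‖²` is presupposed. -/
def NoiseABC (f : H → ℝ) (A C : ℝ) (μ : Measure Ω) (ℱ : Filtration ℕ mΩ)
    (X D : ℕ → Ω → H) : Prop :=
  ∀ k, condLExp (ℱ k) μ (fun ω => ‖D (k + 1) ω‖ₑ ^ 2) ≤ᵐ[μ]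
    fun ω => ENNReal.ofReal (A * (f (X k ω) - f (minNormSolution f)) + C)

end Scheme

end TikhonovSGD

end

/-! The quantity to control is the regularized gap `E_k = f_λ(X_k) - f_λ(x_λ)` with `λ = λ_{k+1}`.
Strong convexity of `f_λ` gives the Polyak-Łojasiewicz inequality, so a step contracts `E_k` by the
factor `1 - α λ`, up to noise and an error of order `λ_k - λ_{k+1} = O(k^(-p-1))` from changing the
objective. A rate for `E_k` yields both claims: `f(X_k) - f(x_*)` exceeds the gap by at most `O(λ)`,
and `‖X_k - x_λ‖²` is at most `4 E_k / λ`. Since `x_λ → x_*` strongly, some rate exponent above `p`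
gives `X_k → x_*`.

To bound `k^γ E_k` with `γ = min β (1 - q)`, a direct Robbins-Siegmund argument fails: the weighted
drift error `k^(γ-p-1)` is not summable once `γ ≥ p`. However, where `k^γ E_k` exceeds `M = 2 ‖x_*‖²
/ Cα`, the contraction dominates this error (`eventually_weighted_drift_le`). The recursion is
therefore applied to `softPart (k^γ E_k - M)`, which ignores everything below the threshold.

The truncation must be smooth enough for the martingale noise to cancel at first order, and flat
enough at infinity for the second order: the linear noise has square at most of order `k^(2γ) α² E
‖D‖²`, and the factor `1 / (1 + t)` in `softPart_add_le_taylor` trades one `k^γ E` for a constant.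
What remains is of order `α² k^γ ‖D‖²`, whose coefficients are summable exactly because `γ < 2q -
1`. Hence the truncated sequence is an almost supermartingale and is almost surely bounded. -/

namespace TikhonovSGD

/-! ### Convex analysis of the regularized objective and its minimizers -/

section Convexity

lemma norm_sq_eq_add_inner_add {H : Type*} [NormedAddCommGroup H] [InnerProductSpace ℝ H]
    (x y : H) :
    ‖y‖ ^ 2 = ‖x‖ ^ 2 + 2 * inner ℝ x (y - x) + ‖y - x‖ ^ 2 := by
  have h := norm_add_sq_real x (y - x)
  rwa [add_sub_cancel] at h

variable {H : Type*} [NormedAddCommGroup H] [InnerProductSpace ℝ H] [CompleteSpace H]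
  {f : H → ℝ} {L : ℝ}

lemma hasDerivAt_along_line (hf : Differentiable ℝ f) (x y : H) (t : ℝ) :
    HasDerivAt (fun s : ℝ => f (AffineMap.lineMap x y s))
      (inner ℝ (gradient f (AffineMap.lineMap x y t)) (y - x)) t := by
  have h := ((hf (AffineMap.lineMap x y t)).hasGradientAt.hasFDerivAt).comp_hasDerivAt t
    (AffineMap.hasDerivAt_lineMap (a := x) (b := y) (x := t))
  rw [InnerProductSpace.toDual_apply_apply] at h
  exact h

/-- Along the segment, `f` minus the quadratic model has nonpositive derivative, by the Lipschitz
bound on the gradient. -/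
lemma le_add_inner_gradient_add_sq (hf : Differentiable ℝ f)
    (hL : ∀ x y, ‖gradient f x - gradient f y‖ ≤ L * ‖x - y‖) (x y : H) :
    f y ≤ f x + inner ℝ (gradient f x) (y - x) + L / 2 * ‖y - x‖ ^ 2 := by
  set h : ℝ → ℝ := fun t => f (AffineMap.lineMap x y t) - t * inner ℝ (gradient f x) (y - x)
    - L / 2 * ‖y - x‖ ^ 2 * t ^ 2 with hh
  have hder : ∀ t, HasDerivAt h (inner ℝ (gradient f (AffineMap.lineMap x y t)) (y - x)
      - inner ℝ (gradient f x) (y - x) - L / 2 * ‖y - x‖ ^ 2 * (2 * t)) t := by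
    intro t
    have h1 := ((hasDerivAt_along_line hf x y t).sub
      ((hasDerivAt_id t).mul_const (inner ℝ (gradient f x) (y - x)))).sub
      (((hasDerivAt_id t).pow 2).const_mul (L / 2 * ‖y - x‖ ^ 2))
    convert! h1 using 1
    simp
  have hanti : AntitoneOn h (Icc 0 1) := by
    refine antitoneOn_of_deriv_nonpos (convex_Icc 0 1)
      (fun t _ => (hder t).continuousAt.continuousWithinAt)
      (fun t _ => (hder t).differentiableAt.differentiableWithinAt) fun t ht => ?_
    rw [interior_Icc] at ht
    rw [(hder t).deriv, ← inner_sub_left]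
    have h1 := real_inner_le_norm (gradient f (AffineMap.lineMap x y t) - gradient f x) (y - x)
    have h2 := hL (AffineMap.lineMap x y t) x
    have h3 : ‖AffineMap.lineMap x y t - x‖ = t * ‖y - x‖ := by
      rw [← dist_eq_norm, dist_lineMap_left, Real.norm_of_nonneg ht.1.le, dist_comm, dist_eq_norm]
    rw [h3] at h2
    have h4 := mul_le_mul_of_nonneg_right h2 (norm_nonneg (y - x))
    nlinarith
  have h01 := hanti (left_mem_Icc.2 zero_le_one) (right_mem_Icc.2 zero_le_one) zero_le_one
  simp only [hh, AffineMap.lineMap_apply_zero, AffineMap.lineMap_apply_one] at h01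
  linarith

lemma add_inner_gradient_le (hf : Differentiable ℝ f) (hc : ConvexOn ℝ univ f) (x y : H) :
    f x + inner ℝ (gradient f x) (y - x) ≤ f y := by
  have hconv : ConvexOn ℝ univ fun s : ℝ => f (AffineMap.lineMap x y s) := by
    exact hc.comp_affineMap (AffineMap.lineMap x y)
  have h := hconv.le_slope_of_hasDerivAt (mem_univ 0) (mem_univ 1) one_pos
    (hasDerivAt_along_line hf x y 0)
  rw [slope_def_field, AffineMap.lineMap_apply_zero, AffineMap.lineMap_apply_one, sub_zero,
    div_one] at h
  linarith

lemma IsSmoothConvexObjective.differentiable (hf : IsSmoothConvexObjective f L) :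
    Differentiable ℝ f :=
  hf.contDiff.differentiable one_ne_zero

lemma IsSmoothConvexObjective.continuous_gradient (hf : IsSmoothConvexObjective f L) :
    Continuous (gradient f) := by
  refine (LipschitzWith.of_dist_le_mul (K := L.toNNReal) fun x y => ?_).continuous
  rw [dist_eq_norm, dist_eq_norm]
  exact (hf.lipschitz_gradient x y).trans
    (mul_le_mul_of_nonneg_right (Real.le_coe_toNNReal L) (norm_nonneg _))

/-- The gradient of the Tikhonov regularized objective. -/
noncomputable def tikhonovGradient (f : H → ℝ) (l : ℝ) (x : H) : H := gradient f x + l • x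

lemma IsSmoothConvexObjective.tikhonov_le (hf : IsSmoothConvexObjective f L) (l : ℝ) (x y : H) :
    tikhonov f l y ≤ tikhonov f l x + inner ℝ (tikhonovGradient f l x) (y - x)
      + (L + l) / 2 * ‖y - x‖ ^ 2 := by
  have h := le_add_inner_gradient_add_sq hf.differentiable hf.lipschitz_gradient x y
  unfold tikhonov tikhonovGradient
  rw [norm_sq_eq_add_inner_add x y, inner_add_left, real_inner_smul_left]
  linarith

lemma IsSmoothConvexObjective.le_tikhonov (hf : IsSmoothConvexObjective f L) (l : ℝ) (x y : H) :
    tikhonov f l x + inner ℝ (tikhonovGradient f l x) (y - x) + l / 2 * ‖y - x‖ ^ 2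
      ≤ tikhonov f l y := by
  have h := add_inner_gradient_le hf.differentiable hf.convexOn x y
  unfold tikhonov tikhonovGradient
  rw [norm_sq_eq_add_inner_add x y, inner_add_left, real_inner_smul_left]
  linarith

/-- The optimality gap of the regularized objective. -/
noncomputable def tikhonovGap (f : H → ℝ) (l : ℝ) (x : H) : ℝ :=
  tikhonov f l x - tikhonov f l (tikhonovMinimizer f l)

variable {l : ℝ}

lemma IsSmoothConvexObjective.tikhonovGap_nonneg (hf : IsSmoothConvexObjective f L) (hl : 0 < l)
    (x : H) : 0 ≤ tikhonovGap f l x :=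
  sub_nonneg.2 (hf.tikhonovMinimizer_mem hl x)

/-- The Polyak-Łojasiewicz inequality for the regularized objective. -/
lemma IsSmoothConvexObjective.gap_le_norm_gradient_sq (hf : IsSmoothConvexObjective f L)
    (hl : 0 < l) (x : H) : 2 * l * tikhonovGap f l x ≤ ‖tikhonovGradient f l x‖ ^ 2 := by
  have h := hf.le_tikhonov l x (tikhonovMinimizer f l)
  set d := tikhonovMinimizer f l - x
  set g := tikhonovGradient f l x
  have h1 := (abs_le.1 (abs_real_inner_le_norm g d)).1
  unfold tikhonovGap
  -- The strongly convex lower bound is minimized over the length of `d`; the minimum is at `‖d‖ =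
  -- ‖g‖ / l`.
  nlinarith [sq_nonneg (‖g‖ - l * ‖d‖)]

/-- A gradient step of length `1 / (L + l)` decreases the objective by at least `‖g‖² / (2 (L +
l))`, and cannot go below the minimum. -/
lemma IsSmoothConvexObjective.norm_gradient_sq_le_gap (hf : IsSmoothConvexObjective f L)
    (hL : 0 < L) (hl : 0 < l) (x : H) :
    ‖tikhonovGradient f l x‖ ^ 2 ≤ 2 * (L + l) * tikhonovGap f l x := by
  set g := tikhonovGradient f l x with hg
  have hB : 0 < L + l := by positivity
  have h := hf.tikhonov_le l x (x - (L + l)⁻¹ • g)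
  have h2 := hf.tikhonovMinimizer_mem hl (x - (L + l)⁻¹ • g)
  have h3 : x - (L + l)⁻¹ • g - x = -((L + l)⁻¹ • g) := by abel
  rw [h3, inner_neg_right, real_inner_smul_right, real_inner_self_eq_norm_sq, norm_neg, norm_smul,
    Real.norm_of_nonneg (by positivity), mul_pow] at h
  have h4 : (L + l) / 2 * ((L + l)⁻¹ ^ 2 * ‖g‖ ^ 2) = (L + l)⁻¹ * ‖g‖ ^ 2 / 2 := by field_simp
  have h5 : ‖g‖ ^ 2 = 2 * (L + l) * ((L + l)⁻¹ * ‖g‖ ^ 2 / 2) := by field_simp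
  rw [h5]
  refine mul_le_mul_of_nonneg_left ?_ (by positivity)
  unfold tikhonovGap
  linarith

lemma IsSmoothConvexObjective.norm_sub_sq_le_gap (hf : IsSmoothConvexObjective f L)
    (hl : 0 < l) (x : H) :
    l / 4 * ‖x - tikhonovMinimizer f l‖ ^ 2 ≤ tikhonovGap f l x := by
  have h1 := tikhonov_midpoint hf.convexOn l x (tikhonovMinimizer f l)
  have h2 := hf.tikhonovMinimizer_mem hl
    ((1 / 2 : ℝ) • x + (1 / 2 : ℝ) • tikhonovMinimizer f l)
  unfold tikhonovGap
  linarith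

lemma IsSmoothConvexObjective.tikhonov_minimizer_le (hf : IsSmoothConvexObjective f L)
    (hl : 0 < l) : tikhonov f l (tikhonovMinimizer f l) ≤
      f (minNormSolution f) + l / 2 * ‖minNormSolution f‖ ^ 2 :=
  hf.tikhonovMinimizer_mem hl _

lemma IsSmoothConvexObjective.norm_tikhonovMinimizer_le (hf : IsSmoothConvexObjective f L)
    (hl : 0 < l) : ‖tikhonovMinimizer f l‖ ≤ ‖minNormSolution f‖ := by
  have h1 := hf.tikhonov_minimizer_le hl
  have h2 := hf.isMinNormSolution.1 (tikhonovMinimizer f l)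
  unfold tikhonov at h1
  refine le_of_sq_le_sq ?_ (norm_nonneg _)
  have : l / 2 * ‖tikhonovMinimizer f l‖ ^ 2 ≤ l / 2 * ‖minNormSolution f‖ ^ 2 := by linarith
  exact le_of_mul_le_mul_left this (by positivity)

/-- The bias of regularization, of order `l`; it is the source of the exponent `p` in the rate for
function values. -/
lemma IsSmoothConvexObjective.sub_min_le_gap (hf : IsSmoothConvexObjective f L)
    (hl : 0 < l) (x : H) :
    f x - f (minNormSolution f) ≤ tikhonovGap f l x + l / 2 * ‖minNormSolution f‖ ^ 2 := by
  have h1 := hf.tikhonov_minimizer_le hl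
  have : 0 ≤ l / 2 * ‖x‖ ^ 2 := by positivity
  unfold tikhonovGap
  rw [tikhonov]
  linarith

/-- Serves only integrability, for which quadratic growth suffices; there is no need to show that
the gradient at the minimizer vanishes. -/
lemma IsSmoothConvexObjective.gap_le_sq_add_mul (hf : IsSmoothConvexObjective f L) (l : ℝ) (x : H) :
    tikhonovGap f l x ≤ (L + l) / 2 * ‖x - tikhonovMinimizer f l‖ ^ 2
      + ‖tikhonovGradient f l (tikhonovMinimizer f l)‖ * ‖x - tikhonovMinimizer f l‖ := by
  have h := hf.tikhonov_le l (tikhonovMinimizer f l) x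
  have h1 := real_inner_le_norm (tikhonovGradient f l (tikhonovMinimizer f l))
    (x - tikhonovMinimizer f l)
  unfold tikhonovGap
  linarith

/-- Decreasing the regularization parameter changes the optimality gap by a multiple of the
decrement. -/
lemma IsSmoothConvexObjective.gap_mono_parameter (hf : IsSmoothConvexObjective f L) {m : ℝ}
    (hm : 0 < m) (hml : m ≤ l) (x : H) :
    tikhonovGap f m x ≤ tikhonovGap f l x + (l - m) / 2 * ‖minNormSolution f‖ ^ 2 := by
  have h1 := hf.tikhonovMinimizer_mem (hm.trans_le hml) (tikhonovMinimizer f m)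
  have h2 := pow_le_pow_left₀ (norm_nonneg _) (hf.norm_tikhonovMinimizer_le hm) 2
  have h3 : (l - m) / 2 * ‖tikhonovMinimizer f m‖ ^ 2
      ≤ (l - m) / 2 * ‖minNormSolution f‖ ^ 2 :=
    mul_le_mul_of_nonneg_left h2 (by linarith)
  have h4 : 0 ≤ (l - m) / 2 * ‖x‖ ^ 2 := mul_nonneg (by linarith) (sq_nonneg _)
  unfold tikhonovGap
  unfold tikhonov at h1 ⊢
  linarith

/-- Adding the strong convexity bound for `f_l` to the optimality of the other minimizer for `f_m`
cancels the values of `f`. The result makes the norms monotone along the trajectory and controls its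
increments by theirs. -/
lemma IsSmoothConvexObjective.norm_minimizer_sub_sq_le (hf : IsSmoothConvexObjective f L) {m : ℝ}
    (hm : 0 < m) (hml : m ≤ l) :
    ‖tikhonovMinimizer f m - tikhonovMinimizer f l‖ ^ 2
      ≤ 2 * (‖tikhonovMinimizer f m‖ ^ 2 - ‖tikhonovMinimizer f l‖ ^ 2) := by
  have hl : 0 < l := hm.trans_le hml
  have h1 := hf.norm_sub_sq_le_gap hl (tikhonovMinimizer f m)
  have h2 := hf.tikhonovMinimizer_mem hm (tikhonovMinimizer f l)
  set D := ‖tikhonovMinimizer f m - tikhonovMinimizer f l‖ ^ 2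
  unfold tikhonovGap at h1
  unfold tikhonov at h1 h2
  set a := ‖tikhonovMinimizer f m‖ ^ 2
  set b := ‖tikhonovMinimizer f l‖ ^ 2
  have hD : 0 ≤ D := sq_nonneg _
  have h3 : l / 4 * D ≤ (l - m) / 2 * (a - b) := by linarith
  have h4 : 0 ≤ a - b := by
    by_contra hneg
    push Not at hneg
    rcases hml.eq_or_lt with rfl | hlt
    · exact hneg.ne (by simp [a, b])
    · nlinarith [mul_pos (sub_pos.2 hlt) (neg_pos.2 hneg), mul_nonneg hl.le hD]
  have h5 : l / 4 * D ≤ l / 4 * (2 * (a - b)) := by nlinarith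
  exact le_of_mul_le_mul_left h5 (by positivity)

/-- Tikhonov trajectories converge strongly to the minimum-norm solution. -/
lemma IsSmoothConvexObjective.tendsto_tikhonovMinimizer (hf : IsSmoothConvexObjective f L)
    {u : ℕ → ℝ} (hu : ∀ n, 0 < u n) (hanti : Antitone u) (hlim : Tendsto u atTop (𝓝 0)) :
    Tendsto (fun n => tikhonovMinimizer f (u n)) atTop (𝓝 (minNormSolution f)) := by
  set x : ℕ → H := fun n => tikhonovMinimizer f (u n) with hx
  have hdiff : ∀ n m, n ≤ m → ‖x m - x n‖ ^ 2 ≤ 2 * (‖x m‖ ^ 2 - ‖x n‖ ^ 2) := fun n m hnm =>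
    hf.norm_minimizer_sub_sq_le (hu m) (hanti hnm)
  have hmono : Monotone fun n => ‖x n‖ ^ 2 := fun n m hnm => by
    have := hdiff n m hnm
    have := sq_nonneg ‖x m - x n‖
    simp only
    linarith
  have hbdd : BddAbove (range fun n => ‖x n‖ ^ 2) := by
    refine ⟨‖minNormSolution f‖ ^ 2, ?_⟩
    rintro _ ⟨n, rfl⟩
    exact pow_le_pow_left₀ (norm_nonneg _) (hf.norm_tikhonovMinimizer_le (hu n)) 2
  have hconv := tendsto_atTop_ciSup hmono hbdd
  set a := ⨆ n, ‖x n‖ ^ 2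
  -- The norms increase to a finite limit, so the squared distances are dominated by the tail of a
  -- convergent real sequence. This gives strong convergence without weak compactness.
  have hcauchy : CauchySeq x := by
    refine cauchySeq_of_le_tendsto_0' (fun n => Real.sqrt (2 * (a - ‖x n‖ ^ 2))) ?_ ?_
    · intro n m hnm
      rw [dist_comm, dist_eq_norm]
      refine Real.le_sqrt_of_sq_le ((hdiff n m hnm).trans ?_)
      have := le_ciSup hbdd m
      linarith
    · have := ((hconv.const_sub a).const_mul 2).sqrt
      simpa using this
  obtain ⟨z, hz⟩ := cauchySeq_tendsto_of_complete hcauchy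
  have hfz : f z ≤ f (minNormSolution f) := by
    have h1 : Tendsto (fun n => f (x n)) atTop (𝓝 (f z)) :=
      (hf.contDiff.continuous.tendsto z).comp hz
    have h2 : Tendsto (fun n => f (minNormSolution f) + u n / 2 * ‖minNormSolution f‖ ^ 2) atTop
        (𝓝 (f (minNormSolution f) + 0 / 2 * ‖minNormSolution f‖ ^ 2)) :=
      ((hlim.div_const 2).mul_const _).const_add _
    simp only [zero_div, zero_mul, add_zero] at h2
    refine le_of_tendsto_of_tendsto' h1 h2 fun n => ?_
    have h3 := hf.tikhonov_minimizer_le (hu n)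
    have h4 : 0 ≤ u n / 2 * ‖x n‖ ^ 2 := mul_nonneg (by linarith [hu n]) (sq_nonneg _)
    unfold tikhonov at h3
    simp only [hx] at h4 ⊢
    linarith
  have hnz : ‖z‖ ≤ ‖minNormSolution f‖ :=
    le_of_tendsto' hz.norm fun n => hf.norm_tikhonovMinimizer_le (hu n)
  have hsol : IsMinNormSolution f z :=
    ⟨fun y => hfz.trans (hf.isMinNormSolution.1 y),
      fun y hy => hnz.trans (hf.isMinNormSolution.2 y hy)⟩
  have := (existsUnique_isMinNormSolution hf.convexOn hf.contDiff.continuous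
    hf.argmin_nonempty).unique hsol hf.isMinNormSolution
  rwa [this] at hz

end Convexity

/-! ### A smooth truncation with a decaying second-order remainder -/

section Truncation

/-- A monotone, convex `C¹` function which vanishes on the negative half-line, grows linearly, and
whose second derivative at `t ≥ 0` is of order `(1 + t)⁻³`. -/
noncomputable def softPart (t : ℝ) : ℝ := max t 0 ^ 2 / (1 + max t 0)

/-- The derivative of `softPart`. -/
noncomputable def softPartDeriv (t : ℝ) : ℝ := 1 - 1 / (1 + max t 0) ^ 2

lemma softPart_nonneg (t : ℝ) : 0 ≤ softPart t := by
  have : 0 ≤ max t 0 := le_max_right _ _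
  unfold softPart
  positivity

lemma softPart_of_nonpos {t : ℝ} (ht : t ≤ 0) : softPart t = 0 := by
  simp [softPart, max_eq_right ht]

lemma softPart_of_nonneg {t : ℝ} (ht : 0 ≤ t) : softPart t = t - 1 + 1 / (1 + t) := by
  rw [softPart, max_eq_left ht]
  field_simp
  ring

lemma le_softPart_add_one (t : ℝ) : max t 0 ≤ softPart t + 1 := by
  rcases le_total t 0 with ht | ht
  · rw [max_eq_right ht]
    linarith [softPart_nonneg t]
  · rw [max_eq_left ht, softPart_of_nonneg ht]
    have : 0 < 1 / (1 + t) := by positivity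
    linarith

lemma softPart_le (t : ℝ) : softPart t ≤ max t 0 := by
  have h : 0 ≤ max t 0 := le_max_right _ _
  rw [softPart, div_le_iff₀ (by positivity)]
  nlinarith

lemma softPart_add_le (t : ℝ) {s : ℝ} (hs : 0 ≤ s) : softPart (t + s) ≤ softPart t + s := by
  have h : 0 ≤ max t 0 := le_max_right _ _
  rcases le_total (t + s) 0 with hts | hts
  · rw [softPart_of_nonpos hts]
    linarith [softPart_nonneg t]
  · rcases le_total t 0 with ht | ht
    · have h1 := softPart_le (t + s)
      rw [max_eq_left hts] at h1
      linarith [softPart_nonneg t]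
    · rw [softPart_of_nonneg hts, softPart_of_nonneg ht]
      have : 1 / (1 + (t + s)) ≤ 1 / (1 + t) :=
        one_div_le_one_div_of_le (by positivity) (by linarith)
      linarith

lemma softPart_mono : Monotone softPart := by
  intro s t hst
  rcases le_total s 0 with hs | hs
  · rw [softPart_of_nonpos hs]
    exact softPart_nonneg t
  · have ht : 0 ≤ t := hs.trans hst
    rw [softPart_of_nonneg hs, softPart_of_nonneg ht]
    have h1 : 1 / (1 + s) - 1 / (1 + t) = (t - s) / ((1 + s) * (1 + t)) := by
      field_simp
      ring
    have h2 : (t - s) / ((1 + s) * (1 + t)) ≤ t - s :=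
      div_le_self (by linarith) (by nlinarith)
    linarith

lemma continuous_softPart : Continuous softPart := by
  unfold softPart
  refine Continuous.div (by fun_prop) (by fun_prop) fun t => ?_
  have : 0 ≤ max t 0 := le_max_right _ _
  positivity

lemma continuous_softPartDeriv : Continuous softPartDeriv := by
  unfold softPartDeriv
  refine continuous_const.sub (Continuous.div (by fun_prop) (by fun_prop) fun t => ?_)
  have : 0 ≤ max t 0 := le_max_right _ _
  positivity

lemma abs_softPartDeriv_le (t : ℝ) : |softPartDeriv t| ≤ 1 := by
  have h : 0 ≤ max t 0 := le_max_right _ _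
  have h1 : 0 < 1 / (1 + max t 0) ^ 2 := by positivity
  have h2 : 1 / (1 + max t 0) ^ 2 ≤ 1 := by
    rw [div_le_one (by positivity)]
    nlinarith
  unfold softPartDeriv
  rw [abs_le]
  constructor <;> linarith

/-- Second order expansion of `softPart` with a remainder that is small at large base points. -/
lemma softPart_add_le_taylor (t n : ℝ) :
    softPart (t + n) ≤ softPart t + softPartDeriv t * n + 2 * n ^ 2 / (1 + max t 0) := by
  rcases le_total t 0 with ht | ht
  · have h1 : softPart (t + n) ≤ max n 0 ^ 2 := by
      refine (softPart_mono (by linarith : t + n ≤ n)).trans ?_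
      have : 0 ≤ max n 0 := le_max_right _ _
      exact div_le_self (sq_nonneg _) (by linarith)
    have h2 : max n 0 ^ 2 ≤ n ^ 2 := by
      rcases le_total n 0 with hn | hn
      · rw [max_eq_right hn]
        nlinarith
      · rw [max_eq_left hn]
    rw [softPart_of_nonpos ht, softPartDeriv, max_eq_right ht]
    norm_num
    nlinarith [sq_nonneg n]
  · rw [softPart_of_nonneg ht, softPartDeriv, max_eq_left ht]
    obtain ⟨u, rfl⟩ : ∃ u, t = u - 1 := ⟨t + 1, by ring⟩
    have hu : 1 ≤ u := by linarith
    have hu0 : 0 < u := by linarith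
    have e : 1 + (u - 1) = u := by ring
    rw [e]
    rcases le_total 0 (u - 1 + n) with hn | hn
    · rw [softPart_of_nonneg hn]
      have hv : 0 < u + n := by linarith
      have e2 : 1 + (u - 1 + n) = u + n := by ring
      rw [e2]
      have h1 : 1 / (u + n) - 1 / u + n / u ^ 2 = n ^ 2 / (u ^ 2 * (u + n)) := by
        field_simp
        ring
      have h2 : n ^ 2 / (u ^ 2 * (u + n)) ≤ 2 * n ^ 2 / u := by
        rw [div_le_div_iff₀ (by positivity) hu0]
        have h3 : u ≤ u ^ 2 * (u + n) := by nlinarith [mul_nonneg (sq_nonneg u) hn]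
        have := mul_le_mul_of_nonneg_left h3 (sq_nonneg n)
        have h4 : 0 ≤ n ^ 2 * (u ^ 2 * (u + n)) := by positivity
        nlinarith
      have h3 : (1 - 1 / u ^ 2) * n = n - n / u ^ 2 := by ring
      linarith
    -- The increment crosses below zero, so `-n` exceeds the base point `u - 1` and the quadratic
    -- term alone beats the linear one. The decay `1 / u` cannot be improved: at `n = -2t` the error
    -- is of order `t`.
    · rw [softPart_of_nonpos hn]
      have h1 : u - 1 - 1 + 1 / u + (1 - 1 / u ^ 2) * n + 2 * n ^ 2 / u
          = ((u - 1) ^ 2 * u + (u ^ 2 - 1) * n + 2 * n ^ 2 * u) / u ^ 2 := by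
        field_simp
        ring
      rw [h1]
      refine div_nonneg ?_ (by positivity)
      obtain ⟨s, rfl⟩ : ∃ s, n = -s := ⟨-n, by ring⟩
      have hs : u - 1 ≤ s := by linarith
      have hs0 : 0 ≤ s := by linarith
      have h2 : (u ^ 2 - 1) * s ≤ s * s * (u + 1) := by
        have := mul_le_mul_of_nonneg_left hs (mul_nonneg hs0 (by linarith : (0 : ℝ) ≤ u + 1))
        nlinarith
      have h3 : 0 ≤ s * s * (u - 1) := mul_nonneg (mul_nonneg hs0 hs0) (by linarith)
      have h4 : 0 ≤ (u - 1) ^ 2 * u := by positivity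
      nlinarith

end Truncation

/-! ### Almost supermartingales and conditional second moments -/

section Probability

variable {Ω : Type*} {mΩ : MeasurableSpace Ω} {μ : Measure Ω}

/-- Nonnegativity bounds the `L¹` norms by the initial mean, so the submartingale `-T` converges
almost surely. -/
lemma ae_bddAbove_of_nonneg_supermartingale [IsProbabilityMeasure μ] {ℱ : Filtration ℕ mΩ}
    {T : ℕ → Ω → ℝ} (hT : Supermartingale T ℱ μ) (h0 : ∀ n ω, 0 ≤ T n ω) :
    ∀ᵐ ω ∂μ, BddAbove (range fun n => T n ω) := by
  have hbdd : ∀ n, eLpNorm ((-T) n) 1 μ ≤ (Real.toNNReal (∫ ω, T 0 ω ∂μ) : NNReal) := by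
    intro n
    rw [Pi.neg_apply, eLpNorm_neg, eLpNorm_one_eq_lintegral_enorm]
    have h1 : ∫⁻ ω, ‖T n ω‖ₑ ∂μ = ENNReal.ofReal (∫ ω, T n ω ∂μ) := by
      rw [ofReal_integral_eq_lintegral_ofReal (hT.integrable n) (ae_of_all _ (h0 n))]
      exact lintegral_congr fun ω => Real.enorm_of_nonneg (h0 n ω)
    rw [h1]
    refine ENNReal.ofReal_le_ofReal ?_
    simpa using hT.setIntegral_le (Nat.zero_le n) MeasurableSet.univ
  filter_upwards [hT.neg.exists_ae_tendsto_of_bdd hbdd] with ω ⟨c, hc⟩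
  have := hc.neg.bddAbove_range
  simpa using this

/-- Nonnegative almost supermartingales are almost surely bounded. -/
lemma ae_bddAbove_of_almost_supermartingale [IsProbabilityMeasure μ] {ℱ : Filtration ℕ mΩ}
    {S : ℕ → Ω → ℝ} (hadp : StronglyAdapted ℱ S) (hint : ∀ n, Integrable (S n) μ)
    (h0 : ∀ n ω, 0 ≤ S n ω) {ε b : ℕ → ℝ} (hε0 : ∀ n, 0 ≤ ε n) (hb0 : ∀ n, 0 ≤ b n)
    (hε : Summable ε) (hb : Summable b)
    (hS : ∀ n, ∀ s, MeasurableSet[ℱ n] s →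
      ∫ ω in s, S (n + 1) ω ∂μ ≤ (1 + ε n) * ∫ ω in s, S n ω ∂μ + b n * μ.real s) :
    ∀ᵐ ω ∂μ, BddAbove (range fun n => S n ω) := by
  -- The discount `e` absorbs the factors `1 + ε`, and adding the tail `B` of the series of `b` pays
  -- for the additive errors; `e S + B` is then a nonnegative supermartingale. As `ε` is summable,
  -- `e` stays away from zero and can be removed at the end.
  set e : ℕ → ℝ := fun n => Real.exp (-∑ j ∈ Finset.range n, ε j) with he
  set B : ℕ → ℝ := fun n => ∑' j, b j - ∑ j ∈ Finset.range n, b j with hB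
  have hB0 : ∀ n, 0 ≤ B n := fun n => sub_nonneg.2 (hb.sum_le_tsum _ fun j _ => hb0 j)
  have he0 : ∀ n, 0 < e n := fun n => Real.exp_pos _
  have he1 : ∀ n, e n ≤ 1 := fun n =>
    Real.exp_le_one_iff.2 (neg_nonpos.2 (Finset.sum_nonneg fun j _ => hε0 j))
  have hestep : ∀ n, e (n + 1) * (1 + ε n) ≤ e n := by
    intro n
    have h1 : e (n + 1) = e n * Real.exp (-ε n) := by
      simp only [he]
      rw [Finset.sum_range_succ, neg_add, Real.exp_add]
    have h2 : Real.exp (-ε n) * (1 + ε n) ≤ Real.exp (-ε n) * Real.exp (ε n) :=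
      mul_le_mul_of_nonneg_left (by linarith [Real.add_one_le_exp (ε n)]) (Real.exp_pos _).le
    rw [← Real.exp_add, neg_add_cancel, Real.exp_zero] at h2
    rw [h1, mul_assoc]
    nlinarith [he0 n]
  set T : ℕ → Ω → ℝ := fun n ω => e n * S n ω + B n with hTdef
  have hT : Supermartingale T ℱ μ := by
    refine supermartingale_of_setIntegral_succ_le (fun n => ?_) (fun n => ?_) fun n s hs => ?_
    · exact ((hadp n).const_mul (e n)).add stronglyMeasurable_const
    · exact ((hint n).const_mul _).add (integrable_const _)
    · have hval : ∀ k, ∫ ω in s, T k ω ∂μ = e k * ∫ ω in s, S k ω ∂μ + B k * μ.real s := by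
        intro k
        simp only [hTdef]
        rw [integral_add ((hint k).const_mul _).integrableOn (integrable_const _).integrableOn,
          integral_const_mul, setIntegral_const, smul_eq_mul, mul_comm (μ.real s)]
      have hI : 0 ≤ ∫ ω in s, S n ω ∂μ := integral_nonneg (h0 n)
      have hm : 0 ≤ μ.real s := measureReal_nonneg
      have hBs : B (n + 1) = B n - b n := by
        simp only [hB]
        rw [Finset.sum_range_succ]
        ring
      rw [hval, hval, hBs]
      have h1 := mul_le_mul_of_nonneg_left (hS n s hs) (he0 (n + 1)).le
      have h2 := mul_le_mul_of_nonneg_right (hestep n) hI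
      have h3 := mul_le_mul_of_nonneg_right (he1 (n + 1)) (mul_nonneg (hb0 n) hm)
      nlinarith
  have hT0 : ∀ n ω, 0 ≤ T n ω := fun n ω =>
    add_nonneg (mul_nonneg (he0 n).le (h0 n ω)) (hB0 n)
  filter_upwards [ae_bddAbove_of_nonneg_supermartingale hT hT0] with ω ⟨K, hK⟩
  refine ⟨Real.exp (∑' j, ε j) * K, ?_⟩
  rintro _ ⟨n, rfl⟩
  have h1 : e n * S n ω ≤ K :=
    (le_add_of_nonneg_right (hB0 n)).trans (hK (mem_range_self n))
  have h2 : Real.exp (-∑' j, ε j) ≤ e n :=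
    Real.exp_le_exp.2 (neg_le_neg (hε.sum_le_tsum _ fun j _ => hε0 j))
  have h3 := (mul_le_mul_of_nonneg_right h2 (h0 n ω)).trans h1
  have h4 := mul_le_mul_of_nonneg_left h3 (Real.exp_pos (∑' j, ε j)).le
  rwa [← mul_assoc, ← Real.exp_add, add_neg_cancel, Real.exp_zero, one_mul] at h4

/-- The filtration `n ↦ ℱ (n + N)`. -/
def shiftFiltration (ℱ : Filtration ℕ mΩ) (N : ℕ) : Filtration ℕ mΩ where
  seq n := ℱ (n + N)
  mono' _ _ h := ℱ.mono (Nat.add_le_add_right h N)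
  le' n := ℱ.le (n + N)

lemma ae_eventually_le_of_almost_supermartingale [IsProbabilityMeasure μ]
    {ℱ : Filtration ℕ mΩ}
    {S : ℕ → Ω → ℝ} (hadp : StronglyAdapted ℱ S) (hint : ∀ n, Integrable (S n) μ)
    (h0 : ∀ n ω, 0 ≤ S n ω) {ε b : ℕ → ℝ} (hε0 : ∀ n, 0 ≤ ε n) (hb0 : ∀ n, 0 ≤ b n)
    (hε : Summable ε) (hb : Summable b)
    (hS : ∀ᶠ n in atTop, ∀ s, MeasurableSet[ℱ n] s →
      ∫ ω in s, S (n + 1) ω ∂μ ≤ (1 + ε n) * ∫ ω in s, S n ω ∂μ + b n * μ.real s) :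
    ∀ᵐ ω ∂μ, ∃ K, ∀ᶠ n in atTop, S n ω ≤ K := by
  obtain ⟨N, hN⟩ := eventually_atTop.1 hS
  have := ae_bddAbove_of_almost_supermartingale (ℱ := shiftFiltration ℱ N)
    (S := fun n => S (n + N)) (fun n => hadp (n + N)) (fun n => hint _) (fun n => h0 _)
    (ε := fun n => ε (n + N)) (b := fun n => b (n + N)) (fun n => hε0 _) (fun n => hb0 _)
    ((summable_nat_add_iff N).2 hε) ((summable_nat_add_iff N).2 hb) (fun n s hs => by
      have := hN (n + N) (Nat.le_add_left N n) s hs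
      rwa [add_right_comm] at this)
  filter_upwards [this] with ω ⟨K, hK⟩
  refine ⟨K, eventually_atTop.2 ⟨N, fun n hn => ?_⟩⟩
  have := hK (mem_range_self (n - N))
  simpa [Nat.sub_add_cancel hn] using this

variable {m : MeasurableSpace Ω}

section Norm

variable {H : Type*} [NormedAddCommGroup H]

lemma setLIntegral_enorm_sq_le [IsFiniteMeasure μ] (hm : m ≤ mΩ) {D : Ω → H} {v : Ω → ℝ}
    (hDv : condLExp m μ (fun ω => ‖D ω‖ₑ ^ 2) ≤ᵐ[μ] fun ω => ENNReal.ofReal (v ω)) {s : Set Ω}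
    (hs : MeasurableSet[m] s) :
    ∫⁻ ω in s, ‖D ω‖ₑ ^ 2 ∂μ ≤ ∫⁻ ω in s, ENNReal.ofReal (v ω) ∂μ := by
  rw [← setLIntegral_condLExp hm μ _ hs]
  exact lintegral_mono_ae (ae_restrict_of_ae hDv)

lemma memLp_two_of_condLExp_le [IsFiniteMeasure μ] (hm : m ≤ mΩ) {D : Ω → H} {v : Ω → ℝ}
    (hDm : AEStronglyMeasurable[mΩ] D μ) (hv : Integrable v μ)
    (hDv : condLExp m μ (fun ω => ‖D ω‖ₑ ^ 2) ≤ᵐ[μ] fun ω => ENNReal.ofReal (v ω)) :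
    MemLp D 2 μ := by
  refine ⟨hDm, ?_⟩
  have h := setLIntegral_enorm_sq_le hm hDv MeasurableSet.univ
  rw [Measure.restrict_univ] at h
  have h2 : ∫⁻ ω, ENNReal.ofReal (v ω) ∂μ < ∞ := hv.lintegral_lt_top
  rw [eLpNorm_lt_top_iff_lintegral_rpow_enorm_lt_top two_ne_zero ENNReal.ofNat_ne_top]
  simpa using h.trans_lt h2

lemma setIntegral_norm_sq_le [IsFiniteMeasure μ] (hm : m ≤ mΩ) {D : Ω → H} {v : Ω → ℝ}
    (hD2 : MemLp D 2 μ) (hv : Integrable v μ) (hv0 : ∀ ω, 0 ≤ v ω)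
    (hDv : condLExp m μ (fun ω => ‖D ω‖ₑ ^ 2) ≤ᵐ[μ] fun ω => ENNReal.ofReal (v ω)) {s : Set Ω}
    (hs : MeasurableSet[m] s) :
    ∫ ω in s, ‖D ω‖ ^ 2 ∂μ ≤ ∫ ω in s, v ω ∂μ := by
  have h := setLIntegral_enorm_sq_le hm hDv hs
  have hDi : Integrable (fun ω => ‖D ω‖ ^ 2) μ := hD2.integrable_norm_pow two_ne_zero
  have h1 : ∫⁻ ω in s, ‖D ω‖ₑ ^ 2 ∂μ = ENNReal.ofReal (∫ ω in s, ‖D ω‖ ^ 2 ∂μ) := by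
    rw [ofReal_integral_eq_lintegral_ofReal hDi.integrableOn
      (ae_of_all _ fun ω => sq_nonneg _)]
    refine lintegral_congr fun ω => ?_
    rw [ENNReal.ofReal_pow (norm_nonneg _), ofReal_norm]
  rw [h1, ← ofReal_integral_eq_lintegral_ofReal hv.integrableOn (ae_of_all _ hv0)] at h
  exact (ENNReal.ofReal_le_ofReal_iff (integral_nonneg hv0)).1 h

end Norm

variable {H : Type*} [NormedAddCommGroup H] [InnerProductSpace ℝ H]

lemma integrable_inner_of_memLp {G D : Ω → H} (hG : MemLp G 2 μ) (hD : MemLp D 2 μ) :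
    Integrable (fun ω => inner ℝ (G ω) (D ω)) μ := by
  refine Integrable.mono' ((hG.integrable_norm_pow two_ne_zero).add
    (hD.integrable_norm_pow two_ne_zero)) (hG.1.inner hD.1) (ae_of_all _ fun ω => ?_)
  have h := norm_inner_le_norm (𝕜 := ℝ) (G ω) (D ω)
  simp only [Pi.add_apply]
  nlinarith [sq_nonneg (‖G ω‖ - ‖D ω‖), norm_nonneg (G ω), norm_nonneg (D ω)]

variable [CompleteSpace H]

/-- `G` is known at the earlier time, so it pulls out of the conditional expectation of the inner
product. -/
lemma setIntegral_inner_eq_zero [IsFiniteMeasure μ] (hm : m ≤ mΩ) {G D : Ω → H}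
    (hG : StronglyMeasurable[m] G)
    (hG2 : MemLp G 2 μ) (hD2 : MemLp D 2 μ) (hD : μ[D | m] =ᵐ[μ] 0) {s : Set Ω}
    (hs : MeasurableSet[m] s) : ∫ ω in s, inner ℝ (G ω) (D ω) ∂μ = 0 := by
  have hint : Integrable (fun ω => inner ℝ (G ω) (D ω)) μ := integrable_inner_of_memLp hG2 hD2
  have h := condExp_bilin_of_stronglyMeasurable_left (innerSL ℝ) hG
    (g := D) (μ := μ) hint (hD2.integrable one_le_two)
  rw [← setIntegral_condExp hm hint hs]
  have h0 : μ[fun ω => inner ℝ (G ω) (D ω) | m] =ᵐ[μ] 0 := by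
    refine EventuallyEq.trans h ?_
    filter_upwards [hD] with ω hω
    simp [hω]
  rw [integral_congr_ae (ae_restrict_of_ae h0)]
  simp

/-- A pathwise one-step bound with a martingale difference noise term and a term quadratic in the
noise passes to conditional expectations. -/
lemma setIntegral_le_of_step_le [IsFiniteMeasure μ] (hm : m ≤ mΩ) {G D : Ω → H} {S R v : Ω → ℝ}
    {η : ℝ} (hη : 0 ≤ η) (hG : StronglyMeasurable[m] G) (hG2 : MemLp G 2 μ) (hD2 : MemLp D 2 μ)
    (hD : μ[D | m] =ᵐ[μ] 0) (hv : Integrable v μ) (hv0 : ∀ ω, 0 ≤ v ω)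
    (hDv : condLExp m μ (fun ω => ‖D ω‖ₑ ^ 2) ≤ᵐ[μ] fun ω => ENNReal.ofReal (v ω))
    (hS : Integrable S μ) (hR : Integrable R μ)
    (hle : ∀ ω, S ω ≤ R ω + inner ℝ (G ω) (D ω) + η * ‖D ω‖ ^ 2) {s : Set Ω}
    (hs : MeasurableSet[m] s) :
    ∫ ω in s, S ω ∂μ ≤ ∫ ω in s, (R ω + η * v ω) ∂μ := by
  have hDi : Integrable (fun ω => ‖D ω‖ ^ 2) μ := hD2.integrable_norm_pow two_ne_zero
  have hint : Integrable (fun ω => inner ℝ (G ω) (D ω)) μ := integrable_inner_of_memLp hG2 hD2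
  have h1 : ∫ ω in s, S ω ∂μ ≤ ∫ ω in s, (R ω + inner ℝ (G ω) (D ω) + η * ‖D ω‖ ^ 2) ∂μ :=
    integral_mono hS.integrableOn ((hR.add hint).add (hDi.const_mul η)).integrableOn hle
  rw [integral_add (f := fun ω => R ω + inner ℝ (G ω) (D ω)) (hR.add hint).integrableOn
    (hDi.const_mul η).integrableOn, integral_add hR.integrableOn hint.integrableOn, integral_const_mul,
    setIntegral_inner_eq_zero hm hG hG2 hD2 hD hs] at h1
  rw [integral_add hR.integrableOn (hv.const_mul η).integrableOn, integral_const_mul]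
  have h2 := mul_le_mul_of_nonneg_left (setIntegral_norm_sq_le hm hD2 hv hv0 hDv hs) hη
  linarith

end Probability

/-! ### Asymptotics of the polynomial schedules and weights -/

section Schedules

lemma polySchedule_pos {C : ℝ} (hC : 0 < C) (r : ℝ) (k : ℕ) : 0 < polySchedule C r (k + 1) := by
  unfold polySchedule
  positivity

lemma polySchedule_antitone {C r : ℝ} (hC : 0 < C) (hr : 0 ≤ r) :
    Antitone fun k => polySchedule C r (k + 1) := by
  intro k j hkj
  refine mul_le_mul_of_nonneg_left ?_ hC.le
  exact Real.rpow_le_rpow_of_nonpos (by positivity) (by exact_mod_cast Nat.succ_le_succ hkj)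
    (neg_nonpos.2 hr)

lemma polySchedule_le {C r : ℝ} (hC : 0 < C) (hr : 0 ≤ r) (k : ℕ) :
    polySchedule C r (k + 1) ≤ C := by
  have h := polySchedule_antitone hC hr (Nat.zero_le k)
  simpa [polySchedule] using h

lemma polySchedule_tendsto (C : ℝ) {r : ℝ} (hr : 0 < r) :
    Tendsto (fun k => polySchedule C r (k + 1)) atTop (𝓝 0) := by
  have h := ((tendsto_rpow_neg_atTop hr).comp
    (tendsto_natCast_atTop_atTop.comp (tendsto_add_atTop_nat 1))).const_mul C
  simpa [polySchedule, Function.comp_def] using h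

lemma polySchedule_sub_le {C r : ℝ} (hC : 0 < C) (hr1 : r ≤ 1) (k : ℕ) :
    polySchedule C r (k + 1) - polySchedule C r (k + 1 + 1)
      ≤ C * ((k + 1 : ℕ) : ℝ) ^ (-r - 1) := by
  set n : ℝ := ((k + 1 : ℕ) : ℝ) with hn
  have hn0 : 0 < n := by positivity
  have hcast : ((k + 1 + 1 : ℕ) : ℝ) = n * (1 + 1 / n) := by
    rw [mul_add, mul_one_div_cancel hn0.ne', hn]
    push_cast
    ring
  -- As `r ≤ 1`, the power is at least `(1 + 1 / n)⁻¹`.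
  have h1 : 1 - 1 / n ≤ (1 + 1 / n) ^ (-r) := by
    have h2 : (1 + 1 / n) ^ (-1 : ℝ) ≤ (1 + 1 / n) ^ (-r) :=
      Real.rpow_le_rpow_of_exponent_le (by linarith [one_div_pos.2 hn0]) (by linarith)
    refine le_trans ?_ h2
    rw [Real.rpow_neg_one, ← one_div, le_div_iff₀ (by positivity)]
    nlinarith [sq_nonneg (1 / n)]
  unfold polySchedule
  rw [hcast, Real.mul_rpow hn0.le (by positivity), Real.rpow_sub_one hn0.ne']
  have h3 := mul_le_mul_of_nonneg_left h1 (mul_pos hC (Real.rpow_pos_of_pos hn0 (-r))).le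
  have h4 : C * (n ^ (-r) / n) = C * n ^ (-r) * (1 / n) := by ring
  rw [h4]
  linarith

lemma rpow_succ_le {γ : ℝ} (h1 : γ ≤ 1) (k : ℕ) :
    ((k + 1 + 1 : ℕ) : ℝ) ^ γ ≤ (1 + 1 / ((k + 1 : ℕ) : ℝ)) * ((k + 1 : ℕ) : ℝ) ^ γ := by
  set n : ℝ := ((k + 1 : ℕ) : ℝ) with hn
  have hn0 : 0 < n := by positivity
  have hcast : ((k + 1 + 1 : ℕ) : ℝ) = (1 + 1 / n) * n := by
    rw [add_mul, one_div_mul_cancel hn0.ne', hn]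
    push_cast
    ring
  rw [hcast, Real.mul_rpow (by positivity) hn0.le]
  refine mul_le_mul_of_nonneg_right ?_ (by positivity)
  calc (1 + 1 / n) ^ γ ≤ (1 + 1 / n) ^ (1 : ℝ) :=
        Real.rpow_le_rpow_of_exponent_le (by linarith [one_div_pos.2 hn0]) h1
    _ = 1 + 1 / n := Real.rpow_one _

lemma polySchedule_mul {C C' r r' : ℝ} (k : ℕ) :
    polySchedule C r (k + 1) * polySchedule C' r' (k + 1)
      = polySchedule (C * C') (r + r') (k + 1) := by
  unfold polySchedule
  rw [neg_add, Real.rpow_add (by positivity)]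
  ring

/-- `1 / n` is eventually dominated by a schedule with exponent below one. -/
lemma eventually_one_div_le_polySchedule {C r : ℝ} (hC : 0 < C) (hr : r < 1) :
    ∀ᶠ k : ℕ in atTop, 1 / ((k + 1 : ℕ) : ℝ) ≤ polySchedule C r (k + 1) := by
  have h := (polySchedule_tendsto 1 (sub_pos.2 hr)).eventually_le_const hC
  filter_upwards [h] with k hk
  have hn0 : 0 < ((k + 1 : ℕ) : ℝ) := by positivity
  unfold polySchedule at hk ⊢
  rw [one_mul] at hk
  have h1 := mul_le_mul_of_nonneg_right hk (Real.rpow_pos_of_pos hn0 (-r)).le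
  rw [← Real.rpow_add hn0] at h1
  have h2 : -(1 - r) + -r = -1 := by ring
  rwa [h2, Real.rpow_neg_one, ← one_div] at h1

lemma summable_polySchedule_sq_mul (C : ℝ) {q γ : ℝ} (hγ1 : γ ≤ 1)
    (h : γ + 1 < 2 * q) :
    Summable fun k => polySchedule C q (k + 1) ^ 2 * ((k + 1 + 1 : ℕ) : ℝ) ^ γ := by
  have h1 : Summable fun k : ℕ => 2 * C ^ 2 * ((k + 1 : ℕ) : ℝ) ^ (γ - 2 * q) :=
    ((summable_nat_add_iff 1).2 (Real.summable_nat_rpow.2 (by linarith))).mul_left _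
  refine Summable.of_nonneg_of_le (fun k => by positivity) (fun k => ?_) h1
  have hn0 : 0 < ((k + 1 : ℕ) : ℝ) := by positivity
  have hn1 : 1 / ((k + 1 : ℕ) : ℝ) ≤ 1 := by
    rw [div_le_one hn0]
    exact_mod_cast Nat.succ_le_succ (Nat.zero_le k)
  have h2 := rpow_succ_le hγ1 k
  have h3 : ((k + 1 + 1 : ℕ) : ℝ) ^ γ ≤ 2 * ((k + 1 : ℕ) : ℝ) ^ γ :=
    h2.trans (mul_le_mul_of_nonneg_right (by linarith) (by positivity))
  refine (mul_le_mul_of_nonneg_left h3 (sq_nonneg _)).trans_eq ?_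
  have h4 : ((k + 1 : ℕ) : ℝ) ^ (γ - 2 * q)
      = ((k + 1 : ℕ) : ℝ) ^ γ * ((k + 1 : ℕ) : ℝ) ^ (-q) * ((k + 1 : ℕ) : ℝ) ^ (-q) := by
    rw [← Real.rpow_add hn0, ← Real.rpow_add hn0]
    ring_nf
  rw [h4, polySchedule]
  ring

/-- The deterministic part of the weighted recursion does not exceed the positive part of the
previous weighted gap, after subtracting a suitable threshold. -/
lemma eventually_weighted_drift_le {Cα Cl p q γ ξ : ℝ} (hCα : 0 < Cα) (hCl : 0 < Cl) (hp : p ≤ 1)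
    (hpq : p + q < 1) (hγ1 : γ ≤ 1) (hγq : γ ≤ 1 - q) (hξ : 0 ≤ ξ)
    (hpq0 : 0 < p + q) :
    ∀ᶠ k : ℕ in atTop, ∀ E : ℝ, 0 ≤ E →
      ((k + 1 + 1 : ℕ) : ℝ) ^ γ *
        ((1 - polySchedule Cα q (k + 1) * polySchedule Cl p (k + 1)) * E
          + (polySchedule Cl p (k + 1) - polySchedule Cl p (k + 1 + 1)) / 2 * ξ) - 2 * ξ / Cα
      ≤ max (((k + 1 : ℕ) : ℝ) ^ γ * E - 2 * ξ / Cα) 0 := by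
  have hC : 0 < Cα * Cl := mul_pos hCα hCl
  filter_upwards [eventually_one_div_le_polySchedule (r := q + p) (half_pos hC) (by linarith),
    (polySchedule_tendsto (Cα * Cl) (by linarith : 0 < q + p)).eventually_le_const one_pos]
    with k hk hk1 E hE
  have hn0 : 0 < ((k + 1 : ℕ) : ℝ) := by positivity
  have hn1 : 1 / ((k + 1 : ℕ) : ℝ) ≤ 1 := by
    rw [div_le_one hn0]
    exact_mod_cast Nat.succ_le_succ (Nat.zero_le k)
  have hw := rpow_succ_le hγ1 k
  have hd := polySchedule_sub_le hCl hp k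
  rw [polySchedule_mul]
  set n : ℝ := ((k + 1 : ℕ) : ℝ) with hn
  set w' : ℝ := ((k + 1 + 1 : ℕ) : ℝ) ^ γ
  set s := polySchedule (Cα * Cl) (q + p) (k + 1) with hs
  set d := polySchedule Cl p (k + 1) - polySchedule Cl p (k + 1 + 1)
  have hw0 : 0 < n ^ γ := Real.rpow_pos_of_pos hn0 γ
  have hw'0 : 0 ≤ w' := by positivity
  have hs0 : 0 < s := polySchedule_pos hC _ _
  have hk2 : 1 / n ≤ s / 2 := by
    refine hk.trans_eq ?_
    rw [hs]
    unfold polySchedule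
    ring
  -- The growth `1 + 1 / n` of the weight costs at most half of the contraction `s`, because `p + q
  -- < 1` makes `1 / n` eventually at most `s / 2`.
  have h1 : w' * (1 - s) ≤ (1 - s / 2) * n ^ γ := by
    have h2 : w' * (1 - s) ≤ (1 + 1 / n) * n ^ γ * (1 - s) :=
      mul_le_mul_of_nonneg_right hw (by linarith)
    have h3 : (1 + 1 / n) * (1 - s) ≤ 1 - s / 2 := by
      have : 0 ≤ 1 / n * s := by positivity
      nlinarith
    calc w' * (1 - s) ≤ (1 + 1 / n) * n ^ γ * (1 - s) := h2
      _ = (1 + 1 / n) * (1 - s) * n ^ γ := by ring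
      _ ≤ _ := mul_le_mul_of_nonneg_right h3 hw0.le
  -- The other half of the contraction, acting on the threshold, pays for the parameter change. This
  -- needs `γ ≤ 1 - q` and fixes the value `2 * ξ / Cα`.
  have h4 : w' * (d / 2 * ξ) ≤ s / 2 * (2 * ξ / Cα) := by
    have h5 : w' ≤ 2 * n ^ γ :=
      hw.trans (mul_le_mul_of_nonneg_right (by linarith) hw0.le)
    have h6 : d / 2 * ξ ≤ Cl * n ^ (-p - 1) / 2 * ξ :=
      mul_le_mul_of_nonneg_right (by linarith) hξ
    have h7 : n ^ γ * n ^ (-p - 1) ≤ n ^ (-(q + p)) := by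
      rw [← Real.rpow_add hn0]
      refine Real.rpow_le_rpow_of_exponent_le ?_ (by linarith)
      rw [hn]
      exact_mod_cast Nat.succ_le_succ (Nat.zero_le k)
    calc w' * (d / 2 * ξ) ≤ w' * (Cl * n ^ (-p - 1) / 2 * ξ) :=
          mul_le_mul_of_nonneg_left h6 hw'0
      _ ≤ 2 * n ^ γ * (Cl * n ^ (-p - 1) / 2 * ξ) :=
          mul_le_mul_of_nonneg_right h5 (by positivity)
      _ = Cl * ξ * (n ^ γ * n ^ (-p - 1)) := by ring
      _ ≤ Cl * ξ * n ^ (-(q + p)) := mul_le_mul_of_nonneg_left h7 (by positivity)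
      _ = s / 2 * (2 * ξ / Cα) := by
          rw [hs, polySchedule]
          field_simp
          simp [hn]
  have h8 := mul_le_mul_of_nonneg_right h1 hE
  set M := 2 * ξ / Cα
  have h9 : w' * ((1 - s) * E + d / 2 * ξ) - M ≤ (1 - s / 2) * (n ^ γ * E - M) := by
    nlinarith
  refine h9.trans ?_
  have h10 : 0 ≤ max (n ^ γ * E - M) 0 := le_max_right _ _
  calc (1 - s / 2) * (n ^ γ * E - M) ≤ (1 - s / 2) * max (n ^ γ * E - M) 0 :=
        mul_le_mul_of_nonneg_left (le_max_left _ _) (by linarith)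
    _ ≤ max (n ^ γ * E - M) 0 := by nlinarith

end Schedules

/-! ### Pathwise one-step inequalities -/

section OneStep

variable {H : Type*} [NormedAddCommGroup H] [InnerProductSpace ℝ H] [CompleteSpace H]
  {f : H → ℝ} {L : ℝ}

/-- Pathwise one-step inequality for the gap of the regularized objective. -/
lemma IsSmoothConvexObjective.gap_step_le (hf : IsSmoothConvexObjective f L)
    {a l l' : ℝ} (ha : 0 ≤ a) (hl' : 0 < l') (hll : l' ≤ l) (hL : 0 < L)
    (hstep : (L + l) * a ≤ 1 / 2) (x D : H) :
    tikhonovGap f l' (x - a • (tikhonovGradient f l x + D)) ≤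
      (1 - a * l) * tikhonovGap f l x + (l - l') / 2 * ‖minNormSolution f‖ ^ 2
        - a * inner ℝ (tikhonovGradient f l x) D + (L + l) * a ^ 2 * ‖D‖ ^ 2 := by
  have hl : 0 < l := hl'.trans_le hll
  set g := tikhonovGradient f l x with hg
  have h1 := hf.gap_mono_parameter hl' hll (x - a • (g + D))
  have h2 := hf.tikhonov_le l x (x - a • (g + D))
  have h3 := hf.gap_le_norm_gradient_sq hl x
  have e : x - a • (g + D) - x = -(a • (g + D)) := by abel
  rw [e, inner_neg_right, real_inner_smul_right, inner_add_right, ← hg,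
    real_inner_self_eq_norm_sq, norm_neg, norm_smul, Real.norm_of_nonneg ha, mul_pow] at h2
  have h4 : ‖g + D‖ ^ 2 ≤ 2 * ‖g‖ ^ 2 + 2 * ‖D‖ ^ 2 := by
    have := parallelogram_law_with_norm ℝ g D
    nlinarith [norm_nonneg (g - D)]
  have h5 := mul_le_mul_of_nonneg_left h4 (by positivity : 0 ≤ (L + l) / 2 * a ^ 2)
  -- The step size restriction leaves half of the descent `a ‖g‖²`, which Polyak-Łojasiewicz turns
  -- into the contraction `a l`.
  have h6 := mul_le_mul_of_nonneg_right hstep (mul_nonneg ha (sq_nonneg ‖g‖))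
  have h7 := mul_le_mul_of_nonneg_left h3 ha
  have h8 : tikhonovGap f l (x - a • (g + D)) ≤ tikhonovGap f l x
      - a * (‖g‖ ^ 2 + inner ℝ g D) + (L + l) / 2 * (a ^ 2 * ‖g + D‖ ^ 2) := by
    unfold tikhonovGap
    linarith
  nlinarith

/-- The weighted gap is controlled by the truncated quantity. -/
lemma IsSmoothConvexObjective.weighted_gap_le (hf : IsSmoothConvexObjective f L)
    {a l l' w M : ℝ} (ha : 0 ≤ a) (hl' : 0 < l') (hll : l' ≤ l) (hL : 0 < L)
    (hstep : (L + l) * a ≤ 1 / 2) (hw : 0 ≤ w) (hM : 0 ≤ M) (x : H) (t : ℝ)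
    (ht : t = w * ((1 - a * l) * tikhonovGap f l x
      + (l - l') / 2 * ‖minNormSolution f‖ ^ 2) - M) :
    w * tikhonovGap f l x ≤ 2 * (1 + M) * (1 + max t 0) := by
  have hE := hf.tikhonovGap_nonneg (hl'.trans_le hll) x
  have h1 : 0 ≤ w * ((l - l') / 2 * ‖minNormSolution f‖ ^ 2) :=
    mul_nonneg hw (mul_nonneg (by linarith) (sq_nonneg _))
  -- Hence at least half of the weighted gap survives in `t + M`.
  have h2 : a * l ≤ 1 / 2 := by nlinarith
  have h3 := mul_le_mul_of_nonneg_left h2 (mul_nonneg hw hE)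
  have h4 : t ≤ max t 0 := le_max_left _ _
  have h5 : 0 ≤ max t 0 := le_max_right _ _
  have h6 : 0 ≤ M * max t 0 := mul_nonneg hM h5
  nlinarith

/-- The threshold-truncated version of the one-step inequality: the noise enters linearly, through
a vector known before the step, and quadratically with a deterministic coefficient. -/
lemma IsSmoothConvexObjective.softPart_step_le (hf : IsSmoothConvexObjective f L)
    {a l l' B w M : ℝ} (ha : 0 ≤ a) (hl' : 0 < l') (hll : l' ≤ l) (hL : 0 < L) (hB : L + l ≤ B)
    (hstep : (L + l) * a ≤ 1 / 2) (hw : 0 ≤ w) (hM : 0 ≤ M) (x D : H) (t : ℝ)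
    (ht : t = w * ((1 - a * l) * tikhonovGap f l x
      + (l - l') / 2 * ‖minNormSolution f‖ ^ 2) - M) :
    softPart (w * tikhonovGap f l' (x - a • (tikhonovGradient f l x + D)) - M) ≤
      softPart t + inner ℝ (-(softPartDeriv t * (w * a)) • tikhonovGradient f l x) D
        + 9 * B * (1 + M) * (w * a ^ 2) * ‖D‖ ^ 2 := by
  have hl : 0 < l := hl'.trans_le hll
  have hB0 : 0 ≤ B := by linarith
  have h1 := mul_le_mul_of_nonneg_left (hf.gap_step_le ha hl' hll hL hstep x D) hw
  have hwE := hf.weighted_gap_le ha hl' hll hL hstep hw hM x t ht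
  have hg := hf.norm_gradient_sq_le_gap hL hl x
  have hE := hf.tikhonovGap_nonneg hl x
  set g := tikhonovGradient f l x
  set E := tikhonovGap f l x
  set r := max t 0 with hr
  have hr0 : 0 ≤ r := le_max_right _ _
  set N := -(w * a * inner ℝ g D) with hN
  set Q := w * ((L + l) * a ^ 2 * ‖D‖ ^ 2) with hQ
  have hQ0 : 0 ≤ Q := by positivity
  have h2 : w * tikhonovGap f l' (x - a • (g + D)) - M ≤ t + N + Q := by
    rw [ht, hN, hQ]
    linarith
  -- The nonnegative quadratic noise `Q` passes through at slope at most one; only the centred term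
  -- `N` needs the second-order expansion.
  have h3 := (softPart_mono h2).trans (softPart_add_le (t + N) hQ0)
  have h4 := softPart_add_le_taylor t N
  have h5 : inner ℝ (-(softPartDeriv t * (w * a)) • g) D = softPartDeriv t * N := by
    rw [real_inner_smul_left, hN]
    ring
  have hgB : ‖g‖ ^ 2 ≤ 2 * B * E :=
    hg.trans (mul_le_mul_of_nonneg_right (by linarith) hE)
  have hN2 : N ^ 2 ≤ (w * a) ^ 2 * (‖g‖ ^ 2 * ‖D‖ ^ 2) := by
    rw [hN, neg_sq, mul_pow, ← mul_pow ‖g‖]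
    refine mul_le_mul_of_nonneg_left ?_ (sq_nonneg _)
    exact sq_le_sq' (abs_le.1 (abs_real_inner_le_norm g D)).1 (real_inner_le_norm g D)
  -- The squared gradient is at most `2 B E`, and the denominator `1 + r` cancels `w E` by `hwE`, so
  -- one power of the weight disappears. Together with the bound on `Q` this gives the constant `9 =
  -- 8 + 1`.
  have hN3 : 2 * N ^ 2 / (1 + r) ≤ 8 * B * (1 + M) * (w * a ^ 2) * ‖D‖ ^ 2 := by
    rw [div_le_iff₀ (by positivity)]
    calc 2 * N ^ 2 ≤ 2 * ((w * a) ^ 2 * (‖g‖ ^ 2 * ‖D‖ ^ 2)) := by linarith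
      _ ≤ 2 * ((w * a) ^ 2 * (2 * B * E * ‖D‖ ^ 2)) := by gcongr
      _ = 4 * B * (w * a ^ 2) * ‖D‖ ^ 2 * (w * E) := by ring
      _ ≤ 4 * B * (w * a ^ 2) * ‖D‖ ^ 2 * (2 * (1 + M) * (1 + r)) := by gcongr
      _ = _ := by ring
  have hQB : Q ≤ B * (1 + M) * (w * a ^ 2) * ‖D‖ ^ 2 := by
    have h6 : L + l ≤ B * (1 + M) := by nlinarith
    calc Q = (L + l) * (w * a ^ 2 * ‖D‖ ^ 2) := by ring
      _ ≤ B * (1 + M) * (w * a ^ 2 * ‖D‖ ^ 2) := by gcongr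
      _ = _ := by ring
  rw [h5]
  linarith

/-- The contribution of the noise variance is absorbed by a summable perturbation. -/
lemma IsSmoothConvexObjective.variance_step_le (hf : IsSmoothConvexObjective f L)
    {a l l' B w M A C : ℝ} (ha : 0 ≤ a) (hl' : 0 < l') (hll : l' ≤ l) (hL : 0 < L)
    (hB : L + l ≤ B) (hstep : (L + l) * a ≤ 1 / 2) (hw : 1 ≤ w) (hM : 0 ≤ M) (hA : 0 ≤ A)
    (x : H) (t : ℝ)
    (ht : t = w * ((1 - a * l) * tikhonovGap f l x
      + (l - l') / 2 * ‖minNormSolution f‖ ^ 2) - M) :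
    9 * B * (1 + M) * (w * a ^ 2) * (A * (f x - f (minNormSolution f)) + C) ≤
      18 * A * B * (1 + M) ^ 2 * a ^ 2 * softPart t
        + 9 * B * (1 + M) * (4 * A * (1 + M) + A * (B / 2 * ‖minNormSolution f‖ ^ 2) + C)
          * (a ^ 2 * w) := by
  have hl : 0 < l := hl'.trans_le hll
  have hB0 : 0 ≤ B := by linarith
  have hwE := hf.weighted_gap_le ha hl' hll hL hstep (by linarith) hM x t ht
  have h1 := hf.sub_min_le_gap hl x
  set E := tikhonovGap f l x
  set ξ := ‖minNormSolution f‖ ^ 2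
  have hξ : 0 ≤ ξ := sq_nonneg _
  have h2 : l / 2 * ξ ≤ B / 2 * ξ := mul_le_mul_of_nonneg_right (by linarith) hξ
  have h3 : A * (f x - f (minNormSolution f)) + C ≤ A * E + (A * (B / 2 * ξ) + C) := by
    have := mul_le_mul_of_nonneg_left (h1.trans (add_le_add_right h2 E)) hA
    linarith
  have h4 : w * E ≤ 2 * (1 + M) * (2 + softPart t) :=
    hwE.trans (mul_le_mul_of_nonneg_left (by linarith [le_softPart_add_one t]) (by positivity))
  calc 9 * B * (1 + M) * (w * a ^ 2) * (A * (f x - f (minNormSolution f)) + C)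
      ≤ 9 * B * (1 + M) * (w * a ^ 2) * (A * E + (A * (B / 2 * ξ) + C)) :=
        mul_le_mul_of_nonneg_left h3 (by positivity)
    _ = 9 * B * (1 + M) * a ^ 2 * A * (w * E)
          + 9 * B * (1 + M) * (w * a ^ 2) * (A * (B / 2 * ξ) + C) := by ring
    _ ≤ 9 * B * (1 + M) * a ^ 2 * A * (2 * (1 + M) * (2 + softPart t))
          + 9 * B * (1 + M) * (w * a ^ 2) * (A * (B / 2 * ξ) + C) := by gcongr
    _ = 18 * A * B * (1 + M) ^ 2 * a ^ 2 * softPart t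
          + 9 * B * (1 + M) * (4 * A * (1 + M)) * a ^ 2 * 1
          + 9 * B * (1 + M) * (w * a ^ 2) * (A * (B / 2 * ξ) + C) := by ring
    _ ≤ 18 * A * B * (1 + M) ^ 2 * a ^ 2 * softPart t
          + 9 * B * (1 + M) * (4 * A * (1 + M)) * a ^ 2 * w
          + 9 * B * (1 + M) * (w * a ^ 2) * (A * (B / 2 * ξ) + C) := by gcongr
    _ = _ := by ring

end OneStep

/-! ### Moments of the iterates and the almost sure rate of the gap -/

section Iterates

variable {H : Type*} [NormedAddCommGroup H] [InnerProductSpace ℝ H] [CompleteSpace H]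
  {f : H → ℝ} {L : ℝ} {Ω : Type*} {mΩ : MeasurableSpace Ω} {μ : Measure Ω}

lemma IsSmoothConvexObjective.continuous_tikhonovGradient (hf : IsSmoothConvexObjective f L)
    (l : ℝ) : Continuous (tikhonovGradient f l) :=
  hf.continuous_gradient.add (continuous_id.const_smul l)

lemma IsSmoothConvexObjective.continuous_tikhonovGap (hf : IsSmoothConvexObjective f L)
    (l : ℝ) : Continuous (tikhonovGap f l) := by
  have := hf.contDiff.continuous
  unfold tikhonovGap tikhonov
  fun_prop

lemma IsSmoothConvexObjective.memLp_tikhonovGradient [IsFiniteMeasure μ]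
    (hf : IsSmoothConvexObjective f L) (l : ℝ) {Y : Ω → H} (hY : MemLp Y 2 μ) :
    MemLp (fun ω => tikhonovGradient f l (Y ω)) 2 μ := by
  have h1 : MemLp (fun ω => gradient f (Y ω) - gradient f 0) 2 μ := by
    refine hY.of_le_mul (c := L) ((hf.continuous_gradient.comp_aestronglyMeasurable hY.1).sub
      aestronglyMeasurable_const) (ae_of_all _ fun ω => ?_)
    simpa using hf.lipschitz_gradient (Y ω) 0
  have h2 := (h1.add (memLp_const (gradient f 0))).add (hY.const_smul l)
  refine h2.ae_eq (ae_of_all _ fun ω => ?_)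
  simp [tikhonovGradient]

lemma IsSmoothConvexObjective.integrable_tikhonovGap [IsFiniteMeasure μ]
    (hf : IsSmoothConvexObjective f L) {l : ℝ} (hl : 0 < l) {Y : Ω → H} (hY : MemLp Y 2 μ) :
    Integrable (fun ω => tikhonovGap f l (Y ω)) μ := by
  have hd : MemLp (fun ω => Y ω - tikhonovMinimizer f l) 2 μ := hY.sub (memLp_const _)
  refine Integrable.mono' (((hd.integrable_norm_pow two_ne_zero).const_mul ((L + l) / 2)).add
    ((hd.integrable one_le_two).norm.const_mul
      ‖tikhonovGradient f l (tikhonovMinimizer f l)‖))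
    ((hf.continuous_tikhonovGap l).comp_aestronglyMeasurable hY.1) (ae_of_all _ fun ω => ?_)
  rw [Real.norm_of_nonneg (hf.tikhonovGap_nonneg hl _)]
  exact hf.gap_le_sq_add_mul l (Y ω)

lemma IsSmoothConvexObjective.integrable_sub_min [IsFiniteMeasure μ]
    (hf : IsSmoothConvexObjective f L) {Y : Ω → H} (hY : MemLp Y 2 μ) :
    Integrable (fun ω => f (Y ω) - f (minNormSolution f)) μ := by
  refine Integrable.mono' ((hf.integrable_tikhonovGap one_pos hY).add
    (integrable_const (1 / 2 * ‖minNormSolution f‖ ^ 2)))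
    ((hf.contDiff.continuous.comp_aestronglyMeasurable hY.1).sub aestronglyMeasurable_const)
    (ae_of_all _ fun ω => ?_)
  rw [Real.norm_of_nonneg (sub_nonneg.2 (hf.isMinNormSolution.1 _))]
  exact hf.sub_min_le_gap one_pos (Y ω)

variable {α l : ℕ → ℝ} {ℱ : Filtration ℕ mΩ} {X D : ℕ → Ω → H} {A C : ℝ}

lemma IsRegSGD.memLp_noise_of_memLp [IsFiniteMeasure μ] (hf : IsSmoothConvexObjective f L)
    (hX : IsRegSGD f α l μ ℱ X D) (hD : NoiseABC f A C μ ℱ X D) {k : ℕ}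
    (hk : MemLp (X k) 2 μ) : MemLp (D (k + 1)) 2 μ :=
  memLp_two_of_condLExp_le (ℱ.le k) (hX.integrable_noise k).1
    (((hf.integrable_sub_min hk).const_mul A).add (integrable_const C)) (hD k)

/-- Square integrability of the noise is derived, not assumed: `f` grows at most quadratically, so
`X k` in `L²` makes the conditional variance bound integrable, which puts `D (k + 1)` and then `X (k
+ 1)` in `L²`. -/
lemma IsRegSGD.memLp [IsFiniteMeasure μ] (hf : IsSmoothConvexObjective f L)
    (hX : IsRegSGD f α l μ ℱ X D) (hD : NoiseABC f A C μ ℱ X D) (k : ℕ) :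
    MemLp (X k) 2 μ := by
  induction k with
  | zero => exact hX.memLp_init
  | succ k ih =>
    have h := ih.sub (((hf.memLp_tikhonovGradient (l (k + 1)) ih).add
      (hX.memLp_noise_of_memLp hf hD ih)).const_smul (α (k + 1)))
    refine h.ae_eq (ae_of_all _ fun ω => ?_)
    simp [hX.step k ω, tikhonovGradient]

lemma IsRegSGD.memLp_noise [IsFiniteMeasure μ] (hf : IsSmoothConvexObjective f L)
    (hX : IsRegSGD f α l μ ℱ X D) (hD : NoiseABC f A C μ ℱ X D) (k : ℕ) :
    MemLp (D (k + 1)) 2 μ :=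
  hX.memLp_noise_of_memLp hf hD (hX.memLp hf hD k)

lemma integrable_softPart {Y : Ω → ℝ} (hY : Integrable Y μ) :
    Integrable (fun ω => softPart (Y ω)) μ := by
  refine Integrable.mono' hY.pos_part (continuous_softPart.comp_aestronglyMeasurable hY.1)
    (ae_of_all _ fun ω => ?_)
  rw [Real.norm_of_nonneg (softPart_nonneg _)]
  exact softPart_le _

/-- The one-step inequality in conditional form, for a single step with small step size. -/
lemma IsRegSGD.setIntegral_softPart_le [IsFiniteMeasure μ] (hf : IsSmoothConvexObjective f L)
    (hX : IsRegSGD f α l μ ℱ X D) (hD : NoiseABC f A C μ ℱ X D) (hA : 0 ≤ A) (hC : 0 ≤ C)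
    (hL : 0 < L) {B M w w' : ℝ} {k : ℕ} (ha : 0 ≤ α (k + 1)) (hl' : 0 < l (k + 1 + 1))
    (hll : l (k + 1 + 1) ≤ l (k + 1)) (hB : L + l (k + 1) ≤ B)
    (hstep : (L + l (k + 1)) * α (k + 1) ≤ 1 / 2) (hw : 1 ≤ w') (hM : 0 ≤ M)
    (hdrift : ∀ E : ℝ, 0 ≤ E → w' * ((1 - α (k + 1) * l (k + 1)) * E
      + (l (k + 1) - l (k + 1 + 1)) / 2 * ‖minNormSolution f‖ ^ 2) - M ≤ max (w * E - M) 0)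
    {s : Set Ω} (hs : MeasurableSet[ℱ k] s) :
    ∫ ω in s, softPart (w' * tikhonovGap f (l (k + 1 + 1)) (X (k + 1) ω) - M) ∂μ ≤
      (1 + 18 * A * B * (1 + M) ^ 2 * α (k + 1) ^ 2) *
        ∫ ω in s, softPart (w * tikhonovGap f (l (k + 1)) (X k ω) - M) ∂μ
      + 9 * B * (1 + M) * (4 * A * (1 + M) + A * (B / 2 * ‖minNormSolution f‖ ^ 2) + C)
          * (α (k + 1) ^ 2 * w') * μ.real s := by
  have hl : 0 < l (k + 1) := hl'.trans_le hll
  have hB0 : 0 ≤ B := by linarith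
  have hXk := hX.memLp hf hD k
  have hXk1 := hX.memLp hf hD (k + 1)
  have hDk := hX.memLp_noise hf hD k
  set a := α (k + 1)
  set lk := l (k + 1)
  set lk' := l (k + 1 + 1)
  set ξ := ‖minNormSolution f‖ ^ 2
  set t : H → ℝ := fun x => w' * ((1 - a * lk) * tikhonovGap f lk x + (lk - lk') / 2 * ξ) - M
    with ht
  have htc : Continuous t := by
    have := hf.continuous_tikhonovGap lk
    fun_prop
  have hti : Integrable (fun ω => t (X k ω)) μ :=
    ((((hf.integrable_tikhonovGap hl hXk).const_mul (1 - a * lk)).add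
      (integrable_const ((lk - lk') / 2 * ξ))).const_mul w').sub (integrable_const M)
  -- The coefficient of the linear noise: a continuous function of `X k`, hence known at time `k`,
  -- and in `L²` since the truncation has slope at most one.
  set G : H → H := fun x => -(softPartDeriv (t x) * (w' * a)) • tikhonovGradient f lk x with hG
  have hGc : Continuous G :=
    (((continuous_softPartDeriv.comp htc).mul continuous_const).neg).smul
      (hf.continuous_tikhonovGradient lk)
  have hG2 : MemLp (fun ω => G (X k ω)) 2 μ := by
    refine (hf.memLp_tikhonovGradient lk hXk).of_le_mul (c := w' * a)
      (hGc.comp_aestronglyMeasurable hXk.1) (ae_of_all _ fun ω => ?_)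
    rw [hG, norm_smul, norm_neg, Real.norm_eq_abs, abs_mul,
      abs_of_nonneg (mul_nonneg (by linarith : 0 ≤ w') ha)]
    have h1 := mul_le_mul_of_nonneg_right (abs_softPartDeriv_le (t (X k ω)))
      (mul_nonneg (by linarith : 0 ≤ w') ha)
    rw [one_mul] at h1
    exact mul_le_mul_of_nonneg_right h1 (norm_nonneg _)
  have hv : Integrable (fun ω => A * (f (X k ω) - f (minNormSolution f)) + C) μ :=
    ((hf.integrable_sub_min hXk).const_mul A).add (integrable_const C)
  have hS : Integrable (fun ω => softPart (w' * tikhonovGap f lk' (X (k + 1) ω) - M)) μ :=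
    integrable_softPart
      (((hf.integrable_tikhonovGap hl' hXk1).const_mul w').sub (integrable_const M))
  have hS0 : Integrable (fun ω => softPart (w * tikhonovGap f lk (X k ω) - M)) μ :=
    integrable_softPart
      (((hf.integrable_tikhonovGap hl hXk).const_mul w).sub (integrable_const M))
  have hmain := setIntegral_le_of_step_le (ℱ.le k)
    (η := 9 * B * (1 + M) * (w' * a ^ 2)) (by positivity)
    (hGc.comp_stronglyMeasurable (hX.adapted_iterates k)) hG2 hDk (hX.condExp_noise k) hv
    (fun ω => add_nonneg (mul_nonneg hA (sub_nonneg.2 (hf.isMinNormSolution.1 _))) hC) (hD k)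
    hS (integrable_softPart hti) (fun ω => by
      have h := hf.softPart_step_le ha hl' hll hL hB hstep (by linarith) hM (X k ω)
        (D (k + 1) ω) (t (X k ω)) rfl
      have e : X (k + 1) ω = X k ω - a • (tikhonovGradient f lk (X k ω) + D (k + 1) ω) :=
        hX.step k ω
      rw [e]
      exact h) hs
  refine hmain.trans ?_
  set c₁ := 18 * A * B * (1 + M) ^ 2 * a ^ 2 with hc₁
  set c₂ := 9 * B * (1 + M) * (4 * A * (1 + M) + A * (B / 2 * ξ) + C) * (a ^ 2 * w')
  have hc₁0 : 0 ≤ c₁ := by positivity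
  have hbound : ∫ ω in s, (softPart (t (X k ω)) + 9 * B * (1 + M) * (w' * a ^ 2) *
        (A * (f (X k ω) - f (minNormSolution f)) + C)) ∂μ
      ≤ ∫ ω in s, ((1 + c₁) * softPart (w * tikhonovGap f lk (X k ω) - M) + c₂) ∂μ := by
    refine integral_mono ((integrable_softPart hti).add (hv.const_mul _)).integrableOn
      ((hS0.const_mul _).add (integrable_const _)).integrableOn fun ω => ?_
    have h1 : 9 * B * (1 + M) * (w' * a ^ 2) * (A * (f (X k ω) - f (minNormSolution f)) + C)
        ≤ c₁ * softPart (t (X k ω)) + c₂ :=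
      hf.variance_step_le ha hl' hll hL hB hstep hw hM hA (X k ω) _ rfl
    have h2 : softPart (t (X k ω)) ≤ softPart (w * tikhonovGap f lk (X k ω) - M) := by
      have h3 := softPart_mono (hdrift _ (hf.tikhonovGap_nonneg hl (X k ω)))
      refine h3.trans ?_
      rcases le_total (w * tikhonovGap f lk (X k ω) - M) 0 with h | h
      · rw [max_eq_right h, softPart_of_nonpos le_rfl]
        exact softPart_nonneg _
      · rw [max_eq_left h]
    have h4 := mul_le_mul_of_nonneg_left h2 (by positivity : 0 ≤ 1 + c₁)
    refine le_trans (b := (1 + c₁) * softPart (t (X k ω)) + c₂) ?_ (add_le_add_left h4 c₂)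
    linarith
  refine hbound.trans_eq ?_
  rw [integral_add (hS0.const_mul _).integrableOn (integrable_const _).integrableOn,
    integral_const_mul, setIntegral_const, smul_eq_mul, mul_comm (μ.real s)]

/-- Almost sure rate for the gap of the regularized objective along the iterates. -/
lemma IsRegSGD.ae_eventually_weighted_gap_le [IsProbabilityMeasure μ] {Cα Cl p q γ : ℝ}
    (hf : IsSmoothConvexObjective f L) (hL : 0 < L)
    (hX : IsRegSGD f (polySchedule Cα q) (polySchedule Cl p) μ ℱ X D)
    (hD : NoiseABC f A C μ ℱ X D) (hA : 0 ≤ A) (hC : 0 ≤ C) (hCα : 0 < Cα) (hCl : 0 < Cl)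
    (hp0 : 0 < p) (hq0 : 0 < q) (hpq : p + q < 1) (hγ0 : 0 ≤ γ) (hγq : γ ≤ 1 - q)
    (hγ2 : γ + 1 < 2 * q) :
    ∀ᵐ ω ∂μ, ∃ K, ∀ᶠ k : ℕ in atTop,
      ((k + 1 : ℕ) : ℝ) ^ γ * tikhonovGap f (polySchedule Cl p (k + 1)) (X k ω) ≤ K := by
  set ξ := ‖minNormSolution f‖ ^ 2
  set M := 2 * ξ / Cα with hMdef
  have hξ : 0 ≤ ξ := sq_nonneg _
  have hM : 0 ≤ M := by positivity
  set B := L + Cl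
  have hB0 : 0 ≤ B := by positivity
  have hsum := summable_polySchedule_sq_mul Cα (by linarith : γ ≤ 1) hγ2
  have hsum0 : Summable fun k => polySchedule Cα q (k + 1) ^ 2 := by
    refine Summable.of_nonneg_of_le (fun k => sq_nonneg _) (fun k => ?_) hsum
    refine le_mul_of_one_le_right (sq_nonneg _) (Real.one_le_rpow ?_ hγ0)
    exact_mod_cast Nat.succ_le_succ (Nat.zero_le (k + 1))
  have hgap := fun k => hf.tikhonovGap_nonneg (polySchedule_pos hCl p k)
  have hae := ae_eventually_le_of_almost_supermartingale (μ := μ) (ℱ := ℱ)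
    -- `X k` is paired with the parameter of index `k + 1`, the one used in the step leaving `X k`.
    (S := fun k ω => softPart
      (((k + 1 : ℕ) : ℝ) ^ γ * tikhonovGap f (polySchedule Cl p (k + 1)) (X k ω) - M))
    (fun k => (continuous_softPart.comp (((hf.continuous_tikhonovGap _).const_mul _).sub
      continuous_const)).comp_stronglyMeasurable (hX.adapted_iterates k))
    (fun k => integrable_softPart (((hf.integrable_tikhonovGap (polySchedule_pos hCl p k)
      (hX.memLp hf hD k)).const_mul _).sub (integrable_const M)))
    (fun k ω => softPart_nonneg _)
    (ε := fun k => 18 * A * B * (1 + M) ^ 2 * polySchedule Cα q (k + 1) ^ 2)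
    (b := fun k => 9 * B * (1 + M) * (4 * A * (1 + M) + A * (B / 2 * ξ) + C) *
      (polySchedule Cα q (k + 1) ^ 2 * ((k + 1 + 1 : ℕ) : ℝ) ^ γ))
    (fun k => by positivity) (fun k => by positivity) (hsum0.mul_left _) (hsum.mul_left _) (by
      filter_upwards [eventually_weighted_drift_le (γ := γ) hCα hCl (by linarith) hpq
        (by linarith) hγq hξ (by linarith),
        ((polySchedule_tendsto Cα hq0).const_mul B).eventually_le_const
          (by norm_num : B * 0 < 1 / 2)] with k hk hk2 s hs
      have hα := polySchedule_pos hCα q k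
      have hlB : L + polySchedule Cl p (k + 1) ≤ B :=
        add_le_add_right (polySchedule_le hCl hp0.le k) L
      exact hX.setIntegral_softPart_le hf hD hA hC hL hα.le (polySchedule_pos hCl p (k + 1))
        (polySchedule_antitone hCl hp0.le (Nat.le_succ k)) hlB
        ((mul_le_mul_of_nonneg_right hlB hα.le).trans hk2)
        (Real.one_le_rpow (by exact_mod_cast Nat.succ_le_succ (Nat.zero_le (k + 1))) hγ0)
        hM hk hs)
  filter_upwards [hae] with ω ⟨K, hK⟩
  refine ⟨K + 1 + M, hK.mono fun k hk => ?_⟩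
  have h1 := le_softPart_add_one
    (((k + 1 : ℕ) : ℝ) ^ γ * tikhonovGap f (polySchedule Cl p (k + 1)) (X k ω) - M)
  have h2 := (le_max_left _ _).trans h1
  linarith

end Iterates

/-! ### From the gap to function values and distances -/

section Rates

lemma isBigO_rpow_succ (r : ℝ) :
    (fun k : ℕ => ((k + 1 : ℕ) : ℝ) ^ r) =O[atTop] fun k : ℕ => (k : ℝ) ^ r := by
  refine Asymptotics.IsBigO.of_bound (2 ^ |r|) ?_
  filter_upwards [eventually_ge_atTop 1] with k hk
  have hk1 : (1 : ℝ) ≤ k := by exact_mod_cast hk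
  have hk0 : (0 : ℝ) < k := by linarith
  have h1 : ((k + 1 : ℕ) : ℝ) = (1 + 1 / (k : ℝ)) * k := by
    rw [add_mul, one_div_mul_cancel hk0.ne']
    push_cast
    ring
  have h2 : 1 / (k : ℝ) ≤ 1 := by rwa [div_le_one hk0]
  have h3 : 0 < 1 / (k : ℝ) := by positivity
  rw [Real.norm_of_nonneg (by positivity), Real.norm_of_nonneg (by positivity), h1,
    Real.mul_rpow (by positivity) hk0.le]
  refine mul_le_mul_of_nonneg_right ?_ (by positivity)
  calc (1 + 1 / (k : ℝ)) ^ r ≤ (1 + 1 / (k : ℝ)) ^ |r| :=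
        Real.rpow_le_rpow_of_exponent_le (by linarith) (le_abs_self r)
    _ ≤ 2 ^ |r| := Real.rpow_le_rpow (by positivity) (by linarith) (abs_nonneg r)

lemma isBigO_rpow_of_eventually_le {u : ℕ → ℝ} {c r : ℝ} (h0 : ∀ k, 0 ≤ u k)
    (h : ∀ᶠ k : ℕ in atTop, u k ≤ c * ((k + 1 : ℕ) : ℝ) ^ r) :
    u =O[atTop] fun k : ℕ => (k : ℝ) ^ r := by
  refine Asymptotics.IsBigO.trans (Asymptotics.IsBigO.of_bound c ?_) (isBigO_rpow_succ r)
  filter_upwards [h] with k hk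
  rwa [Real.norm_of_nonneg (h0 k), Real.norm_of_nonneg (by positivity)]

variable {H : Type*} [NormedAddCommGroup H] [InnerProductSpace ℝ H] [CompleteSpace H]
  {f : H → ℝ} {L : ℝ}

/-- Rates for function values and for the distance to the regularized minimizers follow from a
rate for the regularized gap. -/
lemma IsSmoothConvexObjective.isBigO_of_weighted_gap_le (hf : IsSmoothConvexObjective f L)
    {Cl p β q K : ℝ} (hCl : 0 < Cl) (hpq : p ≤ 1 - q) {x : ℕ → H}
    (hK : ∀ᶠ k : ℕ in atTop, ((k + 1 : ℕ) : ℝ) ^ min β (1 - q) *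
      tikhonovGap f (polySchedule Cl p (k + 1)) (x k) ≤ K) :
    ((fun k : ℕ => f (x k) - f (minNormSolution f)) =O[atTop] fun k : ℕ => (k : ℝ) ^ (-min β p)) ∧
    ((fun k : ℕ => ‖x k - tikhonovMinimizer f (polySchedule Cl p (k + 1))‖ ^ 2)
      =O[atTop] fun k : ℕ => (k : ℝ) ^ (-min (β - p) (1 - q - p))) := by
  have hgap : ∀ᶠ k : ℕ in atTop, tikhonovGap f (polySchedule Cl p (k + 1)) (x k)
      ≤ |K| * ((k + 1 : ℕ) : ℝ) ^ (-min β (1 - q)) := by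
    filter_upwards [hK] with k hk
    have hn0 : 0 < ((k + 1 : ℕ) : ℝ) := by positivity
    rw [Real.rpow_neg hn0.le, ← div_eq_mul_inv, le_div_iff₀ (Real.rpow_pos_of_pos hn0 _), mul_comm]
    exact hk.trans (le_abs_self K)
  constructor
  · refine isBigO_rpow_of_eventually_le (c := |K| + Cl / 2 * ‖minNormSolution f‖ ^ 2)
      (fun k => sub_nonneg.2 (hf.isMinNormSolution.1 _)) ?_
    filter_upwards [hgap] with k hk
    have hn1 : 1 ≤ ((k + 1 : ℕ) : ℝ) := by exact_mod_cast Nat.succ_le_succ (Nat.zero_le k)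
    have h1 := hf.sub_min_le_gap (polySchedule_pos hCl p k) (x k)
    have h2 : ((k + 1 : ℕ) : ℝ) ^ (-min β (1 - q)) ≤ ((k + 1 : ℕ) : ℝ) ^ (-min β p) :=
      Real.rpow_le_rpow_of_exponent_le hn1 (neg_le_neg (min_le_min_left β hpq))
    have h3 : ((k + 1 : ℕ) : ℝ) ^ (-p) ≤ ((k + 1 : ℕ) : ℝ) ^ (-min β p) :=
      Real.rpow_le_rpow_of_exponent_le hn1 (neg_le_neg (min_le_right β p))
    have h4 := mul_le_mul_of_nonneg_left h2 (abs_nonneg K)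
    have h5 := mul_le_mul_of_nonneg_left h3
      (by positivity : 0 ≤ Cl / 2 * ‖minNormSolution f‖ ^ 2)
    have h6 : polySchedule Cl p (k + 1) / 2 * ‖minNormSolution f‖ ^ 2
        = Cl / 2 * ‖minNormSolution f‖ ^ 2 * ((k + 1 : ℕ) : ℝ) ^ (-p) := by
      unfold polySchedule
      ring
    rw [h6] at h1
    linarith
  · refine isBigO_rpow_of_eventually_le (c := 4 / Cl * |K|) (fun k => sq_nonneg _) ?_
    filter_upwards [hgap] with k hk
    have hn0 : 0 < ((k + 1 : ℕ) : ℝ) := by positivity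
    have h1 := (hf.norm_sub_sq_le_gap (polySchedule_pos hCl p k) (x k)).trans hk
    -- Dividing the gap by the regularization parameter costs a factor `(k + 1) ^ p`, which shifts
    -- both exponents in the minimum by `p`.
    have h2 : ((k + 1 : ℕ) : ℝ) ^ (-min (β - p) (1 - q - p))
        = ((k + 1 : ℕ) : ℝ) ^ (-min β (1 - q)) * ((k + 1 : ℕ) : ℝ) ^ p := by
      rw [← Real.rpow_add hn0, min_sub_sub_right]
      ring_nf
    have h3 : ((k + 1 : ℕ) : ℝ) ^ p * ((k + 1 : ℕ) : ℝ) ^ (-p) = 1 := by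
      rw [← Real.rpow_add hn0, add_neg_cancel, Real.rpow_zero]
    have h4 := mul_le_mul_of_nonneg_left h1
      (mul_pos (div_pos four_pos hCl) (Real.rpow_pos_of_pos hn0 p)).le
    set y := ‖x k - tikhonovMinimizer f (polySchedule Cl p (k + 1))‖ ^ 2
    have h5 : 4 / Cl * ((k + 1 : ℕ) : ℝ) ^ p * (polySchedule Cl p (k + 1) / 4 * y) = y := by
      calc 4 / Cl * ((k + 1 : ℕ) : ℝ) ^ p * (polySchedule Cl p (k + 1) / 4 * y)
          = Cl / Cl * (((k + 1 : ℕ) : ℝ) ^ p * ((k + 1 : ℕ) : ℝ) ^ (-p)) * y := by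
            unfold polySchedule
            ring
        _ = y := by rw [h3, div_self hCl.ne', one_mul, one_mul]
    rw [h5] at h4
    rw [h2]
    linarith

end Rates

end TikhonovSGD

theorem theorem4
    {H : Type*} [NormedAddCommGroup H] [InnerProductSpace ℝ H] [CompleteSpace H]
    [TopologicalSpace.SeparableSpace H]
    {Ω : Type*} {mΩ : MeasurableSpace Ω} (μ : Measure Ω) [IsProbabilityMeasure μ]
    (ℱ : Filtration ℕ mΩ) (f : H → ℝ) (L : ℝ) (hL : 0 < L)
    (hf : TikhonovSGD.IsSmoothConvexObjective f L)
    (Cα Cl p q : ℝ) (hCα : 0 < Cα) (hCl : 0 < Cl)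
    (hp : p ∈ Ioo (0 : ℝ) (1 / 3)) (hq : q ∈ Ioo ((p + 1) / 2) (1 - p))
    (X D : ℕ → Ω → H)
    (hX : TikhonovSGD.IsRegSGD f (TikhonovSGD.polySchedule Cα q)
      (TikhonovSGD.polySchedule Cl p) μ ℱ X D)
    (A C : ℝ) (hA : 0 ≤ A) (hC : 0 ≤ C)
    (hD : TikhonovSGD.NoiseABC f A C μ ℱ X D)
    (β : ℝ) (hβ : β ∈ Ioo (0 : ℝ) (2 * q - 1)) :
    (∀ᵐ ω ∂μ, Tendsto (fun k : ℕ => ‖X k ω - TikhonovSGD.minNormSolution f‖) atTop (𝓝 0)) ∧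
    (∀ᵐ ω ∂μ, (fun k : ℕ => f (X k ω) - f (TikhonovSGD.minNormSolution f))
      =O[atTop] fun k : ℕ => (k : ℝ) ^ (-min β p)) ∧
    (∀ᵐ ω ∂μ, (fun k : ℕ =>
        ‖X k ω - TikhonovSGD.tikhonovMinimizer f (TikhonovSGD.polySchedule Cl p (k + 1))‖ ^ 2)
      =O[atTop] fun k : ℕ => (k : ℝ) ^ (-min (β - p) (1 - q - p))) := by
  obtain ⟨hp0, hp1⟩ := hp
  obtain ⟨hq0, hq1⟩ := hq
  have hrates : ∀ b ∈ Ioo (0 : ℝ) (2 * q - 1), ∀ᵐ ω ∂μ,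
      ((fun k : ℕ => f (X k ω) - f (TikhonovSGD.minNormSolution f))
        =O[atTop] fun k : ℕ => (k : ℝ) ^ (-min b p)) ∧
      ((fun k : ℕ =>
        ‖X k ω - TikhonovSGD.tikhonovMinimizer f (TikhonovSGD.polySchedule Cl p (k + 1))‖ ^ 2)
        =O[atTop] fun k : ℕ => (k : ℝ) ^ (-min (b - p) (1 - q - p))) := by
    intro b hb
    have h1 : min b (1 - q) ≤ b := min_le_left _ _
    filter_upwards [hX.ae_eventually_weighted_gap_le hf hL hD hA hC hCα hCl hp0 (by linarith)
      (by linarith) (le_min hb.1.le (by linarith)) (min_le_right b (1 - q))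
      (by linarith [hb.2])] with ω ⟨K, hK⟩
    exact hf.isBigO_of_weighted_gap_le hCl (by linarith) hK
  refine ⟨?_, (hrates β hβ).mono fun ω h => h.1, (hrates β hβ).mono fun ω h => h.2⟩
  have hmin := hf.tendsto_tikhonovMinimizer (TikhonovSGD.polySchedule_pos hCl p)
    (TikhonovSGD.polySchedule_antitone hCl hp0.le) (TikhonovSGD.polySchedule_tendsto Cl hp0)
  -- The given `β` may lie below `p`, where the distance bound does not decay. The midpoint of `p`
  -- and `2 * q - 1` is used instead; it exceeds `p` because `q > (p + 1) / 2`.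
  filter_upwards [hrates ((p + (2 * q - 1)) / 2) ⟨by linarith, by linarith⟩] with ω h
  have hexp : 0 < min ((p + (2 * q - 1)) / 2 - p) (1 - q - p) :=
    lt_min (by linarith) (by linarith)
  have h1 := h.2.trans_tendsto
    ((tendsto_rpow_neg_atTop hexp).comp tendsto_natCast_atTop_atTop)
  have h2 := h1.sqrt
  simp only [Real.sqrt_sq (norm_nonneg _), Real.sqrt_zero] at h2
  have h3 := (tendsto_zero_iff_norm_tendsto_zero.2 h2).add hmin
  simp only [sub_add_cancel, zero_add] at h3
  exact tendsto_iff_norm_sub_tendsto_zero.1 h3
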